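/- **Setting.** For $h\ge 0$ let $\Pi^C_h$ be the cylinder graph: it has $n=2h^2$ vertices $v_i^j$ ($0\le i<2h$, $0\le j<h$) and edges $v_i^j\to v_{i+1}^j$ and $v_i^j\to v_{i+1}^{(j+1) \bmod h}$ for $0\le i\le 2h-2$. Let $\kappa$ be the security parameter, $h=h(\kappa)$ bounded by a polynomial, $q'=q'(\kappa)\in\mathbb N$, $\ell=\lfloor\kappa/q'\rfloor$, and let $\zeta=\zeta(\kappa)\in\{0,1\}^\kappa$ be any fixed input label. The random oracle $\mathcal O$ is uniformly random with outputs in $\{0,1\}^\kappa$; it accepts as queries either a vertex together with at most two $\kappa$-bit strings, or one $\kappa$-bit string. The label of a source $v$ is $\mathcal O(v,\zeta)$ cut to $\ell$ bits; the label of any other vertex $v$ is $\mathcal O(v,\text{labels of the predecessors of }v)$ cut to $\ell$ bits. $\mathcal H_1$ outputs the list of the labels of the $h$ sinks. $\mathcal H_2=\mathcal H_2^{q'}$, on input $x\in\{0,1\}^\kappa$, puts $\rho_0=\mathcal O(x)$, $\rho_1=\mathcal O(x+1)$, draws $q'$ indices of sinks using $\rho_0$ (the $i$-th one is the $i$-th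 block of $\ell$ bits of $\rho_0$, reduced modulo the number of sinks), looks up the labels $y'_1,\dots,y'_{q'}$ at these indices, and outputs $h_\kappa(x)=(y'_1\|\cdots\|y'_{q'})\oplus\rho_1$ (the concatenation being padded with zeros to $\kappa$ bits). **Hardness.** A static-memory hash function family is *$(\Lambda,\tau,q)$-hard* if for every nonnegative $\Delta\in\omega(\log\kappa)$, every static string $R$ of at most $\Lambda-\Delta$ bits (which may depend on $\mathcal O$), every parallel-random-oracle algorithm $\mathcal A$ that makes polynomially many iterations and oracle queries (its computation being otherwise unrestricted and possibly non-uniform; it passes a state from each iteration to the next, the initial state being $R$), and every set $X$ of $q$ inputs, there is a negligible $\varepsilon$ such that for all large $\kappa$ the following event has probability less than $\varepsilon(\kappa)$ over $\mathcal O$ and the coins of $\mathcal A$: $\mathcal A(R)$ outputs exactly the set $\{(x,h_\kappa(x)):x\in X\}$, and the number of time-steps, before the computation ends, at which its state has at least $\Lambda$ bits is less than $\tau$. **Theorem.** There is an absolute constant $c>0$ such that the following holds. Assume that labels have superlogarithmic length, $\ell\in\omega(\log\kappa)$. Let $\lambda=\lambda(\kappa)\ge 0$ and let $\Lambda=\Lambda(\kappa)$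 be a number of bits such that either $\Lambda\in\Theta(\sqrt n)$, or $\Lambda/\ell\in\Theta(\sqrt n)$ with $\Lambda/\ell\le c\sqrt n$ for all large $\kappa$ (that is, $\Lambda$ is $\Theta(\sqrt n)$ when counted in bits, or when counted in labels with a small enough constant). Assume $q'\in\omega(\log\Lambda)$. Then there is $\tau\in\Theta(\sqrt n)$ such that $(\mathcal H_1,\mathcal H_2)$ is $(\Lambda-\lambda,\tau,q)$-hard with $q=\lceil\Lambda/\ell\rceil$, the number of labels that $\Lambda$ bits amount to. -/

import Mathlib

open Filter Asymptotics

noncomputable section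

/-! ### Graphs and labelings -/

/-- A directed acyclic graph: acyclicity is well-foundedness of the edge relation
(for finite vertex sets the two are equivalent). `Adj u v` is an edge from `u` to `v`. -/
structure DAG (V : Type) where
  Adj : V → V → Prop
  wf : WellFounded Adj

/-- The queries that can be put to the random oracle: a vertex with a tuple of at most `δ`
strings (unused places are `none`), which is the form used for labels, or a single string, which
is the form used by the second part of the hash function. -/
abbrev Query (V : Type) (δ κ : ℕ) : Type := (V × (Fin δ → Option (BitVec κ))) ⊕ BitVec κ

/-- An oracle; the random oracle is a uniformly random element of the finite type
`Oracle (Query V δ κ) κ`. -/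
abbrev Oracle (Q : Type) (κ : ℕ) : Type := Q → BitVec κ

namespace DAG

variable {V : Type}

open scoped Classical in
/-- The list of direct predecessors of `v`, in increasing order. -/
def predList [Fintype V] [LinearOrder V] (G : DAG V) (v : V) : List V :=
  (Finset.univ.filter fun u => G.Adj u v).sort (· ≤ ·)

open scoped Classical in
/-- The list of sinks, in increasing order. -/
def sinkList [Fintype V] [LinearOrder V] (G : DAG V) : List V :=
  (Finset.univ.filter fun v => ∀ w, ¬ G.Adj v w).sort (· ≤ ·)

theorem adj_of_mem_predList [Fintype V] [LinearOrder V] {G : DAG V} {u v : V}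
    (h : u ∈ G.predList v) : G.Adj u v := by
  classical
  simpa [predList] using h

/-- The query that asks the oracle for the label of `v`, given a list of strings. -/
def nodeQuery {δ κ : ℕ} (v : V) (l : List (BitVec κ)) : Query V δ κ :=
  Sum.inl (v, fun i => l[i.1]?)

/-- The labeling of `G` with labels of `len` bits, for the oracle `O` and the input label `ζ`:
the label of a source `v` is `O (v, ζ)` and the label of any other vertex `v` is
`O (v, labels of the predecessors of v)`, the oracle's output being cut to `len` bits.
(Labels are padded with zeros when they are put into a query.) -/
def label [Fintype V] [LinearOrder V] (G : DAG V) {δ κ : ℕ} (len : ℕ)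
    (O : Oracle (Query V δ κ) κ) (ζ : BitVec κ) : V → BitVec len :=
  G.wf.fix fun v ih =>
    (O (nodeQuery v
      (if G.predList v = [] then [ζ]
       else (G.predList v).attach.map fun u =>
        (ih u.1 (adj_of_mem_predList u.2)).setWidth κ))).setWidth len

end DAG

/-- The vertices of the cylinder of height `h`: pairs (level, position), with `2 * h` levels of
`h` vertices each, ordered lexicographically. -/
abbrev CylVertex (h : ℕ) : Type := Fin (2 * h) ×ₗ Fin h

/-- The level of a vertex. -/
def CylVertex.level {h : ℕ} (v : CylVertex h) : ℕ := (ofLex v).1.1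

/-- The position of a vertex in its level. -/
def CylVertex.pos {h : ℕ} (v : CylVertex h) : ℕ := (ofLex v).2.1

/-- The cylinder graph of height `h`: the `j`-th vertex of each level but the last has edges to
the `j`-th and to the `(j + 1 mod h)`-th vertex of the next level. -/
def cylinder (h : ℕ) : DAG (CylVertex h) where
  Adj u v := v.level = u.level + 1 ∧ (v.pos = u.pos ∨ v.pos = (u.pos + 1) % h)
  wf := Subrelation.wf (r := InvImage (· < ·) CylVertex.level)
    (fun {u v} huv => by
      have h1 : v.level = u.level + 1 := huv.1
      show u.level < v.level
      omega)
    (InvImage.wf _ Nat.lt_wfRel.wf)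

/-! ### Static-memory hash functions -/

/-- One member of a static-memory hash function family, with security parameter `κ` and static
words of `len` bits: `H₁` computes the static string (a list of words) and `H₂` computes the hash
of a string, given the number of words of the static string and oracle access to it. Both parts
have access to the random oracle. -/
structure StaticHash (Q : Type) (κ len : ℕ) where
  H₁ : Oracle Q κ → List (BitVec len)
  H₂ : Oracle Q κ → ℕ → (ℕ → BitVec len) → BitVec κ → BitVec κ

/-- The oracle that returns the word at a given place of a list. -/
def seek {len : ℕ} (R : List (BitVec len)) (i : ℕ) : BitVec len := R[i]?.getD 0

/-- The hash function described by a pair `(H₁, H₂)`. -/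
def StaticHash.hash {Q : Type} {κ len : ℕ} (S : StaticHash Q κ len) (O : Oracle Q κ)
    (x : BitVec κ) : BitVec κ :=
  S.H₂ O (S.H₁ O).length (seek (S.H₁ O)) x

/-- The graph function of `G` with labels of `len` bits: the labels of the sinks. -/
def graphFunction {V : Type} [Fintype V] [LinearOrder V] (G : DAG V) {δ κ : ℕ} (len : ℕ)
    (O : Oracle (Query V δ κ) κ) (ζ : BitVec κ) : List (BitVec len) :=
  G.sinkList.map (G.label len O ζ)

/-- The `i`-th index into a list of `z` words that is drawn with the random string `ρ₀`: the
`i`-th block of `len` bits of `ρ₀`, read as a number and reduced modulo `z`. -/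
def sampleIndex {κ : ℕ} (len z : ℕ) (ρ₀ : BitVec κ) (i : ℕ) : ℕ :=
  (ρ₀.toNat / 2 ^ (len * i) % 2 ^ len) % z

/-- The concatenation of the words `y 0, …, y (q' - 1)` of `len` bits as a string of `κ` bits
(`len * q' ≤ κ` in all uses; the remaining bits are zero). -/
def concatWords (κ len q' : ℕ) (y : ℕ → BitVec len) : BitVec κ :=
  BitVec.ofNat κ (∑ i ∈ Finset.range q', (y i).toNat * 2 ^ (len * i))

/-- The second part of the hash function, with `q'` look-ups: let `ρ₀ = O(x)` and `ρ₁ = O(x+1)`,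
draw `q'` indices with `ρ₀`, look up the static words there, and output their concatenation
XOR `ρ₁`. -/
def lookupHash {V : Type} {δ κ : ℕ} (len q' : ℕ) (O : Oracle (Query V δ κ) κ) (z : ℕ)
    (sk : ℕ → BitVec len) (x : BitVec κ) : BitVec κ :=
  let ρ₀ := O (Sum.inr x)
  let ρ₁ := O (Sum.inr (x + 1))
  concatWords κ len q' (fun i => sk (sampleIndex len z ρ₀ i)) ^^^ ρ₁

/-- The static-memory hash function of the cylinder of height `h` with `q'` look-ups, labels of
`⌊κ / q'⌋` bits and input label `ζ`. -/
def cylinderHash (h q' κ : ℕ) (ζ : BitVec κ) :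
    StaticHash (Query (CylVertex h) 2 κ) κ (κ / q') where
  H₁ O := graphFunction (cylinder h) (κ / q') O ζ
  H₂ := lookupHash (κ / q') q'

/-! ### Algorithms in the parallel random oracle model -/

/-- What an iteration hands on: the next state, the values appended to the output register, and
whether the computation ends. -/
structure PROMResult (α : Type) where
  state : List Bool
  out : List α
  halt : Bool

/-- An algorithm in the parallel random oracle model, with a string of random coins. In iteration
`i` it computes a batch of queries from the current state (and the coins), is given all the
answers at once, and computes from them the result of the iteration. There is no bound on the
computation done inside an iteration. -/
structure PROMAlg (Q : Type) (κ : ℕ) (α : Type) where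
  coins : ℕ
  query : ℕ → (Fin coins → Bool) → List Bool → List Q
  next : ℕ → (Fin coins → Bool) → List Bool → List (BitVec κ) → PROMResult α

namespace PROMAlg

variable {Q : Type} {κ : ℕ} {α : Type}

/-- The state, the contents of the output register and the halting flag after `i` iterations, on
input `R`, which is the initial state. -/
def config (A : PROMAlg Q κ α) (O : Oracle Q κ) (ρ : Fin A.coins → Bool) (R : List Bool) :
    ℕ → PROMResult α
  | 0 => ⟨R, [], false⟩
  | i + 1 =>
    let c := A.config O ρ R i
    if c.halt then c
    else
      let r := A.next i ρ c.state ((A.query i ρ c.state).map O)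
      ⟨r.state, c.out ++ r.out, r.halt⟩

/-- The set of all values in the output register when the computation ends. -/
def output (A : PROMAlg Q κ α) (O : Oracle Q κ) (ρ : Fin A.coins → Bool) (R : List Bool) : Set α :=
  {y | ∃ i, y ∈ (A.config O ρ R i).out}

/-- The `Λ`-sustained memory complexity of an execution: the number of times, before the end of
the computation, at which the state has at least `Λ` bits. (It is finite for algorithms that
halt.) -/
def sustainedMem (Λ : ℝ) (A : PROMAlg Q κ α) (O : Oracle Q κ) (ρ : Fin A.coins → Bool)
    (R : List Bool) : ℕ :=
  Set.ncard {i : ℕ | (A.config O ρ R i).halt = false ∧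
    Λ ≤ ((A.config O ρ R i).state.length : ℝ)}

end PROMAlg

/-- A family of algorithms is polynomially bounded if, for some polynomial in the security
parameter plus the length of the input, it bounds the number of iterations and the number of
queries in each iteration. Every probabilistic polynomial-time algorithm is of this kind. -/
def IsPolyBounded {Q : ℕ → Type} {α : ℕ → Type} (A : ∀ κ, PROMAlg (Q κ) κ (α κ)) : Prop :=
  ∃ p : Polynomial ℕ, ∀ κ (O : Oracle (Q κ) κ) (ρ : Fin (A κ).coins → Bool) (R : List Bool),
    ((A κ).config O ρ R (p.eval (κ + R.length))).halt = true ∧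
    ∀ i, ((A κ).config O ρ R i).halt = false →
      ((A κ).query i ρ ((A κ).config O ρ R i).state).length ≤ p.eval (κ + R.length)

/-! ### Hardness -/

/-- The probability of an event under the uniform distribution on a finite type. -/
def unifProb {Ω : Type} [Finite Ω] (E : Set Ω) : ℝ := (Nat.card E : ℝ) / (Nat.card Ω : ℝ)

/-- `ε` is negligible. -/
def Negligible (ε : ℕ → ℝ) : Prop := SuperpolynomialDecay atTop (fun κ : ℕ => (κ : ℝ)) ε

/-- `(Λ, τ, q)`-hardness of a static-memory hash function family: for all `Δ ∈ ω(log κ)`, all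
static strings of at most `Λ - Δ` bits (which may depend on the oracle), all polynomially bounded
algorithms and all sets of `q` inputs, the probability that the algorithm, on the static string,
outputs exactly the correct input-output pairs for these inputs, while its state has `Λ` or more
bits for fewer than `τ` time-steps, is negligible. -/
def IsHardSHF {Q : ℕ → Type} [∀ κ, Finite (Q κ)] {len : ℕ → ℕ}
    (S : ∀ κ, StaticHash (Q κ) κ (len κ)) (Λ : ℕ → ℝ) (τ q : ℕ → ℕ) : Prop :=
  ∀ Δ : ℕ → ℝ, (∀ κ, 0 ≤ Δ κ) → (fun κ : ℕ => Real.log κ) =o[atTop] Δ →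
  ∀ (R : ∀ κ, Oracle (Q κ) κ → List Bool)
    (A : ∀ κ, PROMAlg (Q κ) κ (BitVec κ × BitVec κ)), IsPolyBounded A →
  ∀ X : ∀ κ, Finset (BitVec κ),
  ∃ ε : ℕ → ℝ, Negligible ε ∧ ∀ᶠ κ in atTop,
    (∀ O, ((R κ O).length : ℝ) ≤ Λ κ - Δ κ) → (X κ).card = q κ →
    unifProb {ω : Oracle (Q κ) κ × (Fin (A κ).coins → Bool) |
      (A κ).output ω.1 ω.2 (R κ ω.1) = (fun x => (x, (S κ).hash ω.1 x)) '' (X κ : Set (BitVec κ)) ∧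
      (A κ).sustainedMem (Λ κ) ω.1 ω.2 (R κ ω.1) < τ κ} < ε κ

end

/-! The witness is `τ = h`. The proof joins a pebbling bound for the cylinder to a compression
argument that turns executions into pebblings.

Pebbling. Call a vertex free if a pebble-free path leads to it from a source. Pebbles climb such a
path by at most one level per step. Suppose fewer than `h` time-steps have more than `h / 2`
pebbles. Then every time-step comes less than `h` steps after a low one, so a vertex of level at
least `h` that is free at a low time is still bare `h` steps later. A free sink then stays free at
all low times (`Free.of_free`): if it did not, going down its old free path through the upper half
of the cylinder would meet `d + 1` columns and `s + 1` diagonals, `d + s = h - 1`, each with a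
pebble in it, which takes more than `h / 2` pebbles. Hence among any sinks outnumbering the initial
pebbles, one is never pebbled (`IsPebbling.exists_never`).

Compression. Place at time `t` a pebble on each vertex whose label is used from then on before being
asked for. These sets form a legal pebbling (`needed_succ`). If the state has `B` bits and `k`
labels are needed, then the state, a short hint saying where these labels occur, and the remaining
oracle bits determine the oracle, so such oracles have density at most about `2 ^ B` times (number
of hints per label / `2 ^ len`) `^ k` (`ncard_needed_le`). As a hint is much shorter than a label, a
state below `Λ` bits almost never carries `2 * Λ / len` needed labels or more, and this is at most a
small fraction of `h`.

Sampling. The `q' * q` random look-ups hit at least `2 * q` different sinks except with negligible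
probability (`ncard_card_sampledIndices_lt_le`), which is more than the initial state can account
for. One of them can never be pebbled, yet its label enters an output. When `Λ` is at most one
label, a single looked-up sink suffices, and the gap `Δ` makes the initial state too short for it.
-/

/-! ### Pebbling the cylinder -/

namespace CylVertex

variable {h : ℕ}

/-- The position of a vertex, as a residue. -/
def col (v : CylVertex h) : ZMod h := (v.pos : ZMod h)

/-- The diagonal through a vertex: it is constant along edges that change the position. -/
def diag (v : CylVertex h) : ZMod h := v.col - (v.level : ZMod h)

theorem level_lt (v : CylVertex h) : v.level < 2 * h := (ofLex v).1.2

theorem pos_lt (v : CylVertex h) : v.pos < h := (ofLex v).2.2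

theorem ext_level_pos {u v : CylVertex h} (h1 : u.level = v.level) (h2 : u.pos = v.pos) :
    u = v := by
  apply ofLex.injective
  exact Prod.ext (Fin.ext h1) (Fin.ext h2)

theorem pos_eq_iff_col_eq {u v : CylVertex h} : u.pos = v.pos ↔ u.col = v.col := by
  constructor
  · intro e; simp [col, e]
  · intro e
    have := (ZMod.natCast_eq_natCast_iff' _ _ _).1 e
    rwa [Nat.mod_eq_of_lt u.pos_lt, Nat.mod_eq_of_lt v.pos_lt] at this

theorem exists_level_col {l : ℕ} (hl : l < 2 * h) (c : ZMod h) :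
    ∃ v : CylVertex h, v.level = l ∧ v.col = c := by
  have : NeZero h := ⟨by omega⟩
  refine ⟨toLex (⟨l, hl⟩, ⟨c.val, ZMod.val_lt c⟩), rfl, ?_⟩
  simp [col, pos]

theorem adj_iff {u v : CylVertex h} :
    (cylinder h).Adj u v ↔ v.level = u.level + 1 ∧ (v.col = u.col ∨ v.col = u.col + 1) := by
  have h1 : v.pos = u.pos ↔ v.col = u.col := pos_eq_iff_col_eq
  have h2 : v.pos = (u.pos + 1) % h ↔ v.col = u.col + 1 := by
    have h3 : v.col = u.col + 1 ↔ v.pos % h = (u.pos + 1) % h := by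
      rw [← ZMod.natCast_eq_natCast_iff']
      simp [col]
    rw [h3, Nat.mod_eq_of_lt v.pos_lt]
  show _ ∧ (_ ∨ _) ↔ _
  rw [h1, h2]

/-- A vertex is free with respect to a set `P` of pebbled vertices if a path without pebbles
leads to it from a source. -/
inductive Free (P : Set (CylVertex h)) : CylVertex h → Prop
  | source {v : CylVertex h} : v.level = 0 → v ∉ P → Free P v
  | step {u v : CylVertex h} : (cylinder h).Adj u v → Free P u → v ∉ P → Free P v

theorem Free.notMem {P : Set (CylVertex h)} {v : CylVertex h} (hv : Free P v) : v ∉ P := by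
  cases hv <;> assumption

theorem Free.exists_adj {P : Set (CylVertex h)} {v : CylVertex h} (hv : Free P v)
    (hl : v.level ≠ 0) : ∃ u, (cylinder h).Adj u v ∧ Free P u := by
  cases hv with
  | source h0 _ => exact absurd h0 hl
  | step ha hu _ => exact ⟨_, ha, hu⟩

/-- The path straight down to a source stays in the column of `v`. -/
theorem free_of_col_notMem {P : Set (CylVertex h)} (v : CylVertex h)
    (hP : ∀ w ∈ P, w.col ≠ v.col) : Free P v := by
  induction hl : v.level generalizing v with
  | zero => exact .source hl fun hv => hP v hv rfl
  | succ l ih =>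
    obtain ⟨u, hul, huc⟩ := exists_level_col (l := l) (by have := v.level_lt; omega) v.col
    exact .step (adj_iff.2 ⟨by omega, .inl huc.symm⟩) (ih u (by rwa [huc]) hul)
      fun hv => hP v hv rfl

/-- The path to a source that changes the position at every edge stays on the diagonal of `v`. -/
theorem free_of_diag_notMem {P : Set (CylVertex h)} (v : CylVertex h)
    (hP : ∀ w ∈ P, w.diag ≠ v.diag) : Free P v := by
  induction hl : v.level generalizing v with
  | zero => exact .source hl fun hv => hP v hv rfl
  | succ l ih =>
    obtain ⟨u, hul, huc⟩ := exists_level_col (l := l) (by have := v.level_lt; omega) (v.col - 1)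
    have hd : u.diag = v.diag := by
      simp only [diag, huc, hul, hl]; push_cast; ring
    exact .step (adj_iff.2 ⟨by omega, .inr (by rw [huc]; ring)⟩) (ih u (by rwa [hd]) hul)
      fun hv => hP v hv rfl

/-- Walking down a path that is free for `P` from a vertex that is not free for `P'`, all columns
and all diagonals that are met contain a vertex of `P'`. -/
theorem exists_walk_down {P P' : Set (CylVertex h)} {k : ℕ}
    (hPP : ∀ w, Free P w → k ≤ w.level → w ∉ P') (m : ℕ) (v : CylVertex h) (hv : Free P v)
    (hv' : ¬ Free P' v) (hm : k + m ≤ v.level) :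
    ∃ d s : ℕ, d + s = m ∧ (∀ j ≤ d, ∃ w ∈ P', w.col = v.col - j) ∧
      (∀ j ≤ s, ∃ w ∈ P', w.diag = v.diag + j) := by
  have hcol : ∃ w ∈ P', w.col = v.col := by
    by_contra! hc; exact hv' (free_of_col_notMem v hc)
  have hdiag : ∃ w ∈ P', w.diag = v.diag := by
    by_contra! hc; exact hv' (free_of_diag_notMem v hc)
  induction m generalizing v with
  | zero =>
    refine ⟨0, 0, rfl, ?_, ?_⟩ <;> intro j hj <;> obtain rfl : j = 0 := by omega
    · simpa using hcol
    · simpa using hdiag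
  | succ m ih =>
    obtain ⟨u, hadj, hu⟩ := hv.exists_adj (by omega)
    -- `v` carries no pebble of `P'`, so freeness of `u` would pass up the edge to `v`.
    have hu' : ¬ Free P' u := fun hf => hv' (.step hadj hf (hPP v hv (by omega)))
    obtain ⟨hl, hc⟩ := adj_iff.1 hadj
    obtain ⟨d, s, hds, hd, hs⟩ := ih u hu hu' (by omega)
      (by by_contra! hc; exact hu' (free_of_col_notMem u hc))
      (by by_contra! hc; exact hu' (free_of_diag_notMem u hc))
    -- A straight edge keeps the column and meets one new diagonal; the other kind of edge keeps the
    -- diagonal and meets one new column.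
    rcases hc with hc | hc
    · refine ⟨d, s + 1, by omega, by rwa [hc], fun j hj => ?_⟩
      rcases j with _ | j
      · simpa using hdiag
      · obtain ⟨w, hw, e⟩ := hs j (by omega)
        refine ⟨w, hw, ?_⟩
        rw [e]; simp only [diag, hl, hc]; push_cast; ring
    · refine ⟨d + 1, s, by omega, fun j hj => ?_, fun j hj => ?_⟩
      · rcases j with _ | j
        · simpa using hcol
        · obtain ⟨w, hw, e⟩ := hd j (by omega)
          refine ⟨w, hw, ?_⟩
          rw [e, hc]; push_cast; ring
      · obtain ⟨w, hw, e⟩ := hs j hj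
        refine ⟨w, hw, ?_⟩
        rw [e]; simp only [diag, hl, hc]; push_cast; ring

/-- As `d < h`, the `d + 1` residues are distinct, and so are the pebbles found for them. The maps
`g` and `f` are kept general to serve both columns and diagonals. -/
theorem lt_ncard_of_forall_exists {P : Set (CylVertex h)} {d : ℕ} (hd : d < h)
    {g : CylVertex h → ZMod h} {f : ℕ → ZMod h}
    (hf : ∀ i j : ℕ, (i : ZMod h) ≠ j → f i ≠ f j)
    (hg : ∀ j ≤ d, ∃ w ∈ P, g w = f j) : d < P.ncard := by
  have : Nonempty (CylVertex h) := ⟨(hg 0 (Nat.zero_le d)).choose⟩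
  choose! w hw e using hg
  have h1 : (Finset.range (d + 1) : Set ℕ).ncard ≤ P.ncard := by
    refine Set.ncard_le_ncard_of_injOn w (fun j hj => hw j ?_) ?_ P.toFinite
    · simp at hj; omega
    · intro i hi j hj hij
      simp only [Finset.coe_range, Set.mem_Iio] at hi hj
      by_contra hne
      refine hf i j (fun hc => hne ?_) ?_
      · have := (ZMod.natCast_eq_natCast_iff' _ _ _).1 hc
        rwa [Nat.mod_eq_of_lt (by omega), Nat.mod_eq_of_lt (by omega)] at this
      · rw [← e i (by omega), ← e j (by omega), hij]
  rw [Set.ncard_coe_finset, Finset.card_range] at h1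
  omega

/-- A free vertex on the last level stays free when the pebbles move to a small set of vertices
that are not free or of low level. -/
theorem Free.of_free {P P' : Set (CylVertex h)}
    (hPP : ∀ w, Free P w → h ≤ w.level → w ∉ P') (hcard : 2 * P'.ncard ≤ h)
    {v : CylVertex h} (hv : Free P v) (hlast : v.level + 1 = 2 * h) : Free P' v := by
  by_contra hv'
  -- From level `2 * h - 1` there are `h - 1` edges down to level `h`. Adding `d < |P'|` and `s <
  -- |P'|` gives `h + 1 ≤ 2 * |P'|`.
  obtain ⟨d, s, hds, hd, hs⟩ := exists_walk_down hPP (h - 1) v hv hv' (by omega)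
  have h1 : d < P'.ncard := lt_ncard_of_forall_exists (by omega)
    (f := fun j => v.col - j) (fun i j hij => by simpa using hij) hd
  have h2 : s < P'.ncard := lt_ncard_of_forall_exists (by omega)
    (f := fun j => v.diag + j) (fun i j hij => by simpa using hij) hs
  omega

/-- A sequence of sets of vertices is a legal parallel pebbling (from an arbitrary first set) if
vertices are pebbled only when all their predecessors carry pebbles. -/
def IsPebbling (P : ℕ → Set (CylVertex h)) : Prop :=
  ∀ t, ∀ v ∈ P (t + 1), v ∈ P t ∨ ∀ u, (cylinder h).Adj u v → u ∈ P t

/-- Along a bare path from a source, a vertex can be pebbled only after the one below it, so the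
pebbles climb at most one level per step. Only the source can be pebbled in the first step. -/
theorem IsPebbling.notMem_add {P : ℕ → Set (CylVertex h)} (hP : IsPebbling P) {t : ℕ}
    (j : ℕ) {v : CylVertex h} (hv : Free (P t) v) (hj : j ≤ v.level) :
    v ∉ P (t + j) := by
  induction j generalizing v with
  | zero => exact hv.notMem
  | succ j ih =>
    intro hmem
    rcases hP _ v hmem with h1 | h1
    · exact ih hv (by omega) h1
    · obtain ⟨u, hadj, hu⟩ := hv.exists_adj (by omega)
      have hl := (adj_iff.1 hadj).1
      exact ih hu (by omega) (h1 u hadj)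

/-- All times passed when going back from `i` to the last low time are high. -/
theorem exists_last_low {low : ℕ → Prop} (hlow0 : low 0) (hfin : {i | ¬ low i}.Finite)
    (hhigh : {i | ¬ low i}.ncard < h) (i : ℕ) : ∃ t ≤ i, low t ∧ i - t < h := by
  classical
  have hex : ∃ s, low (i - s) := ⟨i, by simpa using hlow0⟩
  refine ⟨i - Nat.find hex, Nat.sub_le _ _, Nat.find_spec hex, ?_⟩
  have hle : Nat.find hex ≤ i := Nat.find_min' hex (by simpa using hlow0)
  have h1 : (Finset.range (Nat.find hex) : Set ℕ).ncard ≤ {i | ¬ low i}.ncard := by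
    refine Set.ncard_le_ncard_of_injOn (fun s => i - s) (fun s hs => ?_) ?_ hfin
    · exact Nat.find_min hex (by simpa using hs)
    · intro a ha b hb hab
      simp only [Finset.coe_range, Set.mem_Iio] at ha hb
      simp only at hab
      omega
  rw [Set.ncard_coe_finset, Finset.card_range] at h1
  omega

/-- If a legal pebbling of the cylinder has more than `h / 2` pebbles for less than `h`
time-steps, then among any set of sinks that is larger than the set of pebbles in the beginning
there is one that can never be pebbled. -/
theorem IsPebbling.exists_never {P : ℕ → Set (CylVertex h)} (hP : IsPebbling P) {low : ℕ → Prop}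
    (hlow0 : low 0) (hfin : {i | ¬ low i}.Finite) (hhigh : {i | ¬ low i}.ncard < h)
    (hlow : ∀ t, low t → 2 * (P t).ncard ≤ h) {D : Set (CylVertex h)}
    (hDlast : ∀ v ∈ D, v.level + 1 = 2 * h) (hD : (P 0).ncard < D.ncard) :
    ∃ v ∈ D, ∀ t, v ∉ P t ∧ ∃ u, (cylinder h).Adj u v ∧ u ∉ P t := by
  -- Vertices of `D` share a level, hence lie in different columns; there are too few pebbles to
  -- occupy all of these columns.
  obtain ⟨v, hvD, hv0⟩ : ∃ v ∈ D, Free (P 0) v := by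
    by_contra! hc
    have : ∀ v ∈ D, ∃ w ∈ P 0, w.col = v.col := by
      intro v hv
      by_contra! hw
      exact hc v hv (free_of_col_notMem v hw)
    choose! w hw e using this
    refine absurd hD (not_lt.2 (Set.ncard_le_ncard_of_injOn w hw ?_ (Set.toFinite _)))
    intro a ha b hb hab
    refine ext_level_pos ?_ (pos_eq_iff_col_eq.2 ?_)
    · have := hDlast a ha; have := hDlast b hb; omega
    · rw [← e a ha, ← e b hb, hab]
  have hvl := hDlast v hvD
  have hfree : ∀ t, low t → Free (P t) v := by
    intro t
    induction t using Nat.strong_induction_on with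
    | _ t ih =>
      intro ht
      rcases t with _ | t
      · exact hv0
      obtain ⟨s, hst, hs, hlt⟩ := exists_last_low hlow0 hfin hhigh t
      -- The low time `s` satisfies `t + 1 - s ≤ h`, which is why levels from `h` upwards are out of
      -- reach.
      refine (ih s (by omega) hs).of_free (fun w hw hwl => ?_) (hlow _ ht) hvl
      have := hP.notMem_add (t + 1 - s) hw (by omega)
      rwa [show s + (t + 1 - s) = t + 1 by omega] at this
  refine ⟨v, hvD, fun t => ?_⟩
  obtain ⟨s, hst, hs, hlt⟩ := exists_last_low hlow0 hfin hhigh t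
  have hvs := hfree s hs
  have hts : s + (t - s) = t := by omega
  refine ⟨?_, ?_⟩
  · have := hP.notMem_add (t - s) hvs (by omega)
    rwa [hts] at this
  -- A bare predecessor is wanted too: a label may be asked for and output in the same step, without
  -- being needed there.
  · obtain ⟨u, hadj, hu⟩ := hvs.exists_adj (by omega)
    have hl := (adj_iff.1 hadj).1
    refine ⟨u, hadj, ?_⟩
    have := hP.notMem_add (t - s) hu (by omega)
    rwa [hts] at this

end CylVertex

/-! ### Counting oracles that are determined by less information -/

section Counting

variable {κ len k : ℕ} {Q : Type}

theorem BitVec.toNat_div_add_mod_lt (a : BitVec len) (b : BitVec κ) (hlen : len ≤ κ) :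
    b.toNat / 2 ^ len * 2 ^ len + a.toNat < 2 ^ κ := by
  obtain ⟨d, rfl⟩ := Nat.exists_eq_add_of_le hlen
  have hb := b.isLt
  have ha := a.isLt
  have h1 : b.toNat / 2 ^ len < 2 ^ d := by
    rw [Nat.div_lt_iff_lt_mul (by positivity), ← pow_add, Nat.add_comm d]; exact hb
  calc b.toNat / 2 ^ len * 2 ^ len + a.toNat < (b.toNat / 2 ^ len + 1) * 2 ^ len := by
        rw [Nat.add_mul, Nat.one_mul]; omega
    _ ≤ 2 ^ d * 2 ^ len := Nat.mul_le_mul_right _ h1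
    _ = 2 ^ (len + d) := by rw [pow_add, mul_comm]

/-- The string `b` with its low bits replaced by `a`. -/
def BitVec.replaceLow (b : BitVec κ) (a : BitVec len) : BitVec κ :=
  BitVec.ofNat κ (b.toNat / 2 ^ len * 2 ^ len + a.toNat)

theorem BitVec.toNat_replaceLow (a : BitVec len) (b : BitVec κ) (hlen : len ≤ κ) :
    (b.replaceLow a).toNat = b.toNat / 2 ^ len * 2 ^ len + a.toNat := by
  rw [BitVec.replaceLow, BitVec.toNat_ofNat, Nat.mod_eq_of_lt (toNat_div_add_mod_lt a b hlen)]

theorem BitVec.replaceLow_div (a : BitVec len) (b : BitVec κ) (hlen : len ≤ κ) :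
    (b.replaceLow a).toNat / 2 ^ len = b.toNat / 2 ^ len := by
  rw [toNat_replaceLow a b hlen, Nat.add_comm, Nat.add_mul_div_right _ _ (by positivity),
    Nat.div_eq_of_lt a.isLt, Nat.zero_add]

theorem BitVec.replaceLow_right_injective (b : BitVec κ) (hlen : len ≤ κ) :
    Function.Injective (b.replaceLow : BitVec len → BitVec κ) := by
  intro a a' h
  have := congrArg BitVec.toNat h
  rw [toNat_replaceLow a b hlen, toNat_replaceLow a' b hlen] at this
  exact BitVec.eq_of_toNat_eq (by omega)

theorem BitVec.eq_of_setWidth_eq_of_div_eq {b b' : BitVec κ}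
    (h1 : b.setWidth len = b'.setWidth len) (h2 : b.toNat / 2 ^ len = b'.toNat / 2 ^ len) :
    b = b' := by
  have := congrArg BitVec.toNat h1
  rw [BitVec.toNat_setWidth, BitVec.toNat_setWidth] at this
  apply BitVec.eq_of_toNat_eq
  rw [← Nat.div_add_mod b.toNat (2 ^ len), ← Nat.div_add_mod b'.toNat (2 ^ len), h2, this]

/-- If the oracles in `E` are determined by the high bits of all answers and the low bits of the
answers outside `k` places, then there are few of them. -/
theorem ncard_mul_two_pow_le [Finite Q] (hlen : len ≤ κ) (E : Set (Oracle Q κ))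
    (S : Oracle Q κ → Fin k → Q) (hS : ∀ O ∈ E, Function.Injective (S O))
    (hE : ∀ O ∈ E, ∀ O' ∈ E, (∀ x, (O x).toNat / 2 ^ len = (O' x).toNat / 2 ^ len) →
      (∀ x, x ∉ Set.range (S O) → x ∉ Set.range (S O') → O x = O' x) → O = O') :
    E.ncard * 2 ^ (len * k) ≤ Nat.card (Oracle Q κ) := by
  classical
  -- Overwriting the low bits at the `k` places by arbitrary words is injective: high bits and
  -- answers off the places survive, so by `hE` the original oracle, hence its places, hence the
  -- words can be recovered.
  let Φ : E × (Fin k → BitVec len) → Oracle Q κ := fun p x =>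
    if hx : ∃ e, S p.1 e = x then (p.1.1 x).replaceLow (p.2 hx.choose) else p.1.1 x
  have hdiv : ∀ p x, (Φ p x).toNat / 2 ^ len = (p.1.1 x).toNat / 2 ^ len := by
    intro p x
    simp only [Φ]
    split
    · exact BitVec.replaceLow_div _ _ hlen
    · rfl
  have hoff : ∀ p x, x ∉ Set.range (S p.1) → Φ p x = p.1.1 x := by
    intro p x hx
    simp only [Φ]
    rw [dif_neg (by simpa using hx)]
  have hΦ : Function.Injective Φ := by
    rintro ⟨⟨O, hO⟩, r⟩ ⟨⟨O', hO'⟩, r'⟩ h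
    have hOO : O = O' := by
      refine hE O hO O' hO' (fun x => ?_) (fun x hx hx' => ?_)
      · have h1 := hdiv ⟨⟨O, hO⟩, r⟩ x
        have h2 := hdiv ⟨⟨O', hO'⟩, r'⟩ x
        rw [← h1, h, h2]
      · have h1 := hoff ⟨⟨O, hO⟩, r⟩ x hx
        have h2 := hoff ⟨⟨O', hO'⟩, r'⟩ x hx'
        simp only at h1 h2
        rw [← h1, h, h2]
    subst hOO
    congr 1
    funext e
    have hex : ∃ e', S O e' = S O e := ⟨e, rfl⟩
    have he : hex.choose = e := hS O hO hex.choose_spec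
    have h1 := congrFun h (S O e)
    simp only [Φ, dif_pos hex, he] at h1
    exact BitVec.replaceLow_right_injective _ hlen h1
  have := Nat.card_le_card_of_injective Φ hΦ
  rw [Nat.card_prod, Nat.card_coe_set_eq] at this
  have hc : Nat.card (Fin k → BitVec len) = 2 ^ (len * k) := by
    rw [Nat.card_fun, Nat.card_eq_of_equiv_fin (BitVec.equivFin.toEquiv : BitVec len ≃ Fin (2 ^ len)),
      Nat.card_fin, ← pow_mul]
  rwa [hc] at this

end Counting

/-! ### Queries for labels -/

theorem Nat.sum_mul_two_pow_lt {len : ℕ} (y : ℕ → ℕ) (hy : ∀ i, y i < 2 ^ len) (q : ℕ) :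
    ∑ i ∈ Finset.range q, y i * 2 ^ (len * i) < 2 ^ (len * q) := by
  induction q with
  | zero => simp
  | succ q ih =>
    rw [Finset.sum_range_succ, Nat.mul_succ, pow_add]
    have := Nat.mul_le_mul_right (2 ^ (len * q)) (hy q)
    rw [Nat.succ_mul, Nat.mul_comm (2 ^ len)] at this
    omega

theorem Nat.eq_of_sum_mul_two_pow_eq {len : ℕ} {y y' : ℕ → ℕ} (hy : ∀ i, y i < 2 ^ len)
    (hy' : ∀ i, y' i < 2 ^ len) {q : ℕ}
    (h : ∑ i ∈ Finset.range q, y i * 2 ^ (len * i) = ∑ i ∈ Finset.range q, y' i * 2 ^ (len * i))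
    {m : ℕ} (hm : m < q) : y m = y' m := by
  induction q with
  | zero => omega
  | succ q ih =>
    rw [Finset.sum_range_succ, Finset.sum_range_succ] at h
    have h1 := Nat.sum_mul_two_pow_lt y hy q
    have h2 := Nat.sum_mul_two_pow_lt y' hy' q
    have h3 : y q = y' q := by
      have := congrArg (· / 2 ^ (len * q)) h
      simpa [Nat.add_mul_div_right _ _ (Nat.two_pow_pos (len * q)), Nat.div_eq_of_lt h1,
        Nat.div_eq_of_lt h2] using this
    rcases Nat.lt_succ_iff_lt_or_eq.1 hm with hm | rfl
    · exact ih (by rw [h3] at h; omega) hm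
    · exact h3

theorem concatWords_inj {κ len q' : ℕ} (hq : len * q' ≤ κ) {y y' : ℕ → BitVec len}
    (h : concatWords κ len q' y = concatWords κ len q' y') {m : ℕ} (hm : m < q') :
    y m = y' m := by
  have h1 := congrArg BitVec.toNat h
  have hlt : ∀ y : ℕ → BitVec len,
      ∑ i ∈ Finset.range q', (y i).toNat * 2 ^ (len * i) < 2 ^ κ := fun y =>
    (Nat.sum_mul_two_pow_lt _ (fun i => (y i).isLt) q').trans_le
      (Nat.pow_le_pow_right (by norm_num) hq)
  rw [concatWords, concatWords, BitVec.toNat_ofNat, BitVec.toNat_ofNat,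
    Nat.mod_eq_of_lt (hlt y), Nat.mod_eq_of_lt (hlt y')] at h1
  exact BitVec.eq_of_toNat_eq
    (Nat.eq_of_sum_mul_two_pow_eq (fun i => (y i).isLt) (fun i => (y' i).isLt) h1 hm)

theorem exists_getElem?_eq_some {α : Type} {bs : ℕ → List α} {T i : ℕ} (hT : ∀ i, T ≤ i → bs i = []) (hlen : ∀ i, (bs i).length ≤ T)
    {x : α} (hx : x ∈ bs i) : ∃ i' m : Fin T, i'.1 = i ∧ (bs i)[m.1]? = some x := by
  have hi : i < T := by
    by_contra hi
    rw [hT i (by omega)] at hx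
    simp at hx
  obtain ⟨m, hm, e⟩ := List.mem_iff_getElem.1 hx
  exact ⟨⟨i, hi⟩, ⟨m, hm.trans_le (hlen i)⟩, rfl, by rw [List.getElem?_eq_getElem hm, e]⟩

namespace DAG

variable {V : Type} [Fintype V] [LinearOrder V] (G : DAG V) {δ κ : ℕ} (len q' : ℕ) (ζ : BitVec κ)

/-- The query whose answer determines the label of `v`. -/
noncomputable def properQuery (O : Oracle (Query V δ κ) κ) (v : V) : Query V δ κ :=
  nodeQuery v (if G.predList v = [] then [ζ]
    else (G.predList v).map fun u => (G.label len O ζ u).setWidth κ)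

theorem label_eq (O : Oracle (Query V δ κ) κ) (v : V) :
    G.label len O ζ v = (O (G.properQuery len ζ O v)).setWidth len := by
  rw [label, WellFounded.fix_eq, properQuery]
  congr 4
  exact List.attach_map_val (l := G.predList v) (f := fun u => (G.label len O ζ u).setWidth κ)

theorem properQuery_inj {O O' : Oracle (Query V δ κ) κ} {v w : V}
    (h : G.properQuery len ζ O v = G.properQuery len ζ O' w) : v = w := by
  have := Sum.inl.inj h
  exact (Prod.ext_iff.1 this).1

theorem properQuery_congr {O O' : Oracle (Query V δ κ) κ} {v : V}
    (h : ∀ u, G.Adj u v → G.label len O ζ u = G.label len O' ζ u) :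
    G.properQuery len ζ O v = G.properQuery len ζ O' v := by
  rw [properQuery, properQuery]
  congr 2
  exact List.map_congr_left fun u hu => by rw [h u (adj_of_mem_predList hu)]

/-- The word at a place of the tuple of a query, cut to `len` bits. -/
def slot (s : Fin δ) : Query V δ κ → BitVec len
  | Sum.inl p => ((p.2 s).getD 0).setWidth len
  | Sum.inr _ => 0

theorem slot_properQuery (hlen : len ≤ κ) (O : Oracle (Query V δ κ) κ) {u v : V} {s : Fin δ}
    (hs : (G.predList v)[s.1]? = some u) :
    slot len s (G.properQuery len ζ O v) = G.label len O ζ u := by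
  have hne : G.predList v ≠ [] := by
    intro h; simp [h] at hs
  simp only [properQuery, nodeQuery, slot, if_neg hne, List.getElem?_map, hs, Option.map_some,
    Option.getD_some]
  rw [BitVec.setWidth_setWidth_of_le _ hlen, BitVec.setWidth_eq]

theorem mem_predList {u v : V} : u ∈ G.predList v ↔ G.Adj u v := by
  classical
  simp [predList]

/-- The hash function that looks up `q'` labels of sinks. -/
noncomputable abbrev sinkHash (O : Oracle (Query V δ κ) κ) (x : BitVec κ) : BitVec κ :=
  lookupHash len q' O (graphFunction G len O ζ).length (seek (graphFunction G len O ζ)) x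

/-- The `m`-th look-up in the evaluation of the hash function at `x` is that of the sink `v`. -/
def LooksUp (O : Oracle (Query V δ κ) κ) (x : BitVec κ) (m : ℕ) (v : V) : Prop :=
  G.sinkList[sampleIndex len G.sinkList.length (O (Sum.inr x)) m]? = some v

/-- The indices and the mask depend only on answers to single strings, on which the oracles agree.
The mask cancels, and block `m` belongs to the same sink for both. -/
theorem label_eq_of_sinkHash_eq (hq : len * q' ≤ κ) {O O' : Oracle (Query V δ κ) κ}
    (hO : ∀ x, O (Sum.inr x) = O' (Sum.inr x)) {x : BitVec κ}
    (h : G.sinkHash len q' ζ O x = G.sinkHash len q' ζ O' x) {m : ℕ} (hm : m < q') {v : V}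
    (hv : G.LooksUp len O x m v) : G.label len O ζ v = G.label len O' ζ v := by
  simp only [sinkHash, lookupHash] at h
  rw [hO (x + 1)] at h
  have h1 := concatWords_inj hq ((BitVec.xor_left_inj _).1 h) hm
  simp only [graphFunction, List.length_map, seek, List.getElem?_map] at h1
  have hv' : G.LooksUp len O' x m v := by rwa [LooksUp, ← hO]
  rw [LooksUp] at hv hv'
  rw [hv, hv'] at h1
  simpa using h1

/-! ### Labels that are needed -/

/-- The label of `v` is asked for in step `i`, where `bs i` is the batch of queries of step `i`. -/
def Computed (O : Oracle (Query V δ κ) κ) (bs : ℕ → List (Query V δ κ)) (i : ℕ) (v : V) : Prop :=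
  G.properQuery len ζ O v ∈ bs i

/-- The vertices whose labels occur, from step `t` on, in a query for a label or in an output
before they have been asked for. -/
def needed (O : Oracle (Query V δ κ) κ) (X : Finset (BitVec κ)) (bs : ℕ → List (Query V δ κ))
    (os : ℕ → List (BitVec κ × BitVec κ)) (t : ℕ) : Set V :=
  {v | ∃ i, t ≤ i ∧ (∀ j, t ≤ j → j < i → ¬ G.Computed len ζ O bs j v) ∧
    ((∃ w, G.Adj v w ∧ G.Computed len ζ O bs i w) ∨
      (¬ G.Computed len ζ O bs i v ∧
        ∃ x ∈ X, (x, G.sinkHash len q' ζ O x) ∈ os i ∧ ∃ m < q', G.LooksUp len O x m v))}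

variable {O : Oracle (Query V δ κ) κ} {X : Finset (BitVec κ)} {bs : ℕ → List (Query V δ κ)}
  {os : ℕ → List (BitVec κ × BitVec κ)}

theorem mem_needed_of_computed {t : ℕ} {u v : V} (hadj : G.Adj u v)
    (hv : G.Computed len ζ O bs t v) : u ∈ G.needed len q' ζ O X bs os t :=
  ⟨t, le_rfl, fun j h1 h2 => by omega, .inl ⟨v, hadj, hv⟩⟩

/-- Legality of the pebbling: a label that becomes needed only after step `t` was asked for in step
`t`, and that query contains the labels of all predecessors. -/
theorem needed_succ {t : ℕ} {v : V} (hv : v ∈ G.needed len q' ζ O X bs os (t + 1)) :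
    v ∈ G.needed len q' ζ O X bs os t ∨ ∀ u, G.Adj u v → u ∈ G.needed len q' ζ O X bs os t := by
  by_cases hc : G.Computed len ζ O bs t v
  · exact .inr fun u hu => G.mem_needed_of_computed len q' ζ hu hc
  · obtain ⟨i, hti, hcomp, huse⟩ := hv
    refine .inl ⟨i, by omega, fun j htj hji => ?_, huse⟩
    rcases eq_or_lt_of_le htj with rfl | htj
    · exact hc
    · exact hcomp j htj hji

/-- An output of step `i` is computed after the answers of step `i`, so its labels may come from the
batch of that very step; then the predecessors are needed instead. -/
theorem mem_needed_of_mem_output {i : ℕ} {x : BitVec κ} (hx : x ∈ X)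
    (hout : (x, G.sinkHash len q' ζ O x) ∈ os i) {m : ℕ} (hm : m < q') {v : V}
    (hv : G.LooksUp len O x m v) :
    v ∈ G.needed len q' ζ O X bs os i ∨ ∀ u, G.Adj u v → u ∈ G.needed len q' ζ O X bs os i := by
  by_cases hc : G.Computed len ζ O bs i v
  · exact .inr fun u hu => G.mem_needed_of_computed len q' ζ hu hc
  · exact .inl ⟨i, le_rfl, fun j h1 h2 => by omega, .inr ⟨hc, x, hx, hout, m, hm, hv⟩⟩

/-! ### Hints from which needed labels can be read off -/

/-- A place from which a needed label can be read off: a place in one of the queries, or a block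
of an output. -/
abbrev UsePlace (δ κ q' T : ℕ) (X : Finset (BitVec κ)) : Type :=
  (Fin T × Fin T × Fin δ) ⊕ (X × Fin q')

/-- The label of `v` can be read off at a place before it has been asked for. -/
def IsUse (O : Oracle (Query V δ κ) κ) (bs : ℕ → List (Query V δ κ))
    (os : ℕ → List (BitVec κ × BitVec κ)) (t : ℕ) (v : V) {T : ℕ} : UsePlace δ κ q' T X → Prop
  | Sum.inl (i, m, s) => t ≤ i.1 ∧ (∀ j, t ≤ j → j < i.1 → ¬ G.Computed len ζ O bs j v) ∧
      ∃ w, (bs i)[m.1]? = some (G.properQuery len ζ O w) ∧ (G.predList w)[s.1]? = some v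
  | Sum.inr (x, m) => ∃ i, t ≤ i ∧ (∀ j, t ≤ j → j ≤ i → ¬ G.Computed len ζ O bs j v) ∧
      (x.1, G.sinkHash len q' ζ O x) ∈ os i ∧ G.LooksUp len O x m v

/-- The place, if any, where the label of `v` is asked for first. -/
def IsFirst (O : Oracle (Query V δ κ) κ) (bs : ℕ → List (Query V δ κ)) (t : ℕ) (v : V) {T : ℕ} :
    Option (Fin T × Fin T) → Prop
  | none => ∀ j, t ≤ j → ¬ G.Computed len ζ O bs j v
  | some (i, m) => t ≤ i.1 ∧ (∀ j, t ≤ j → j < i.1 → ¬ G.Computed len ζ O bs j v) ∧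
      (bs i)[m.1]? = some (G.properQuery len ζ O v)

theorem exists_isUse {T t : ℕ} (hT : ∀ i, T ≤ i → bs i = []) (hlen : ∀ i, (bs i).length ≤ T)
    (hδ : ∀ v, (G.predList v).length ≤ δ) {v : V} (hv : v ∈ G.needed len q' ζ O X bs os t) :
    ∃ u : UsePlace δ κ q' T X, G.IsUse len q' ζ O bs os t v u := by
  obtain ⟨i, hti, hcomp, ⟨w, hadj, hw⟩ | ⟨hc, x, hx, hout, m, hm, hl⟩⟩ := hv
  · obtain ⟨i', m, rfl, hm⟩ := exists_getElem?_eq_some hT hlen hw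
    obtain ⟨s, hs, e⟩ := List.mem_iff_getElem.1 ((G.mem_predList).2 hadj)
    exact ⟨.inl (i', m, ⟨s, hs.trans_le (hδ w)⟩), hti, hcomp, w, hm,
      by rw [List.getElem?_eq_getElem hs, e]⟩
  · refine ⟨.inr (⟨x, hx⟩, ⟨m, hm⟩), i, hti, fun j h1 h2 => ?_, hout, hl⟩
    rcases eq_or_lt_of_le h2 with rfl | h2
    · exact hc
    · exact hcomp j h1 h2

theorem exists_isFirst {T : ℕ} (t : ℕ) (hT : ∀ i, T ≤ i → bs i = [])
    (hlen : ∀ i, (bs i).length ≤ T) (v : V) :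
    ∃ f : Option (Fin T × Fin T), G.IsFirst len ζ O bs t v f := by
  classical
  by_cases h : ∃ j, t ≤ j ∧ G.Computed len ζ O bs j v
  · obtain ⟨h1, h2⟩ := Nat.find_spec h
    obtain ⟨i, m, e, hm⟩ := exists_getElem?_eq_some hT hlen h2
    refine ⟨some (i, m), by omega, fun j htj hj hc => ?_, by rw [e]; exact hm⟩
    exact Nat.find_min h (by omega) ⟨htj, hc⟩
  · push Not at h
    exact ⟨none, h⟩

/-- The place holds the label in either execution, and the two executions have the same content
there. Agreement is required only up to the moment when the label is asked for, so that the lemma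
can be used inside an induction on time. -/
theorem label_eq_of_isUse (hlen : len ≤ κ) (hq : len * q' ≤ κ)
    {O' : Oracle (Query V δ κ) κ} {bs' : ℕ → List (Query V δ κ)}
    {os' : ℕ → List (BitVec κ × BitVec κ)} {T t : ℕ} {v : V} {u : UsePlace δ κ q' T X}
    (hu : G.IsUse len q' ζ O bs os t v u) (hu' : G.IsUse len q' ζ O' bs' os' t v u)
    (hbs : ∀ i, t ≤ i → (∀ j, t ≤ j → j < i → ¬ G.Computed len ζ O bs j v) → bs i = bs' i)
    (hos : ∀ i, t ≤ i → (∀ j, t ≤ j → j ≤ i → ¬ G.Computed len ζ O bs j v) → os i = os' i)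
    (hout : ∀ i, ∀ p ∈ os' i, p.1 ∈ X → p.2 = G.sinkHash len q' ζ O' p.1)
    (hO : ∀ x, O (Sum.inr x) = O' (Sum.inr x)) : G.label len O ζ v = G.label len O' ζ v := by
  rcases u with ⟨i, m, s⟩ | ⟨x, m⟩
  · obtain ⟨hti, hc, w, hw, hs⟩ := hu
    obtain ⟨-, -, w', hw', hs'⟩ := hu'
    rw [hbs i hti hc, hw', Option.some_inj] at hw
    rw [← G.slot_properQuery len ζ hlen O hs, ← G.slot_properQuery len ζ hlen O' hs', hw]
  · obtain ⟨i, hti, hc, hmem, hl⟩ := hu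
    rw [hos i hti hc] at hmem
    exact G.label_eq_of_sinkHash_eq len q' ζ hq hO (hout i _ hmem x.2) m.2 hl

end DAG

/-! ### Executions -/

namespace PROMAlg

variable {Q : Type} {κ : ℕ} {α : Type} (A : PROMAlg Q κ α) (O : Oracle Q κ)
  (ρ : Fin A.coins → Bool) (R : List Bool)

/-- The queries made in step `i`. -/
def batch (i : ℕ) : List Q :=
  if (A.config O ρ R i).halt then [] else A.query i ρ (A.config O ρ R i).state

/-- The values that are output in step `i`. -/
def outs (i : ℕ) : List α :=
  if (A.config O ρ R i).halt then []
  else (A.next i ρ (A.config O ρ R i).state ((A.batch O ρ R i).map O)).out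

theorem config_succ_of_halt {i : ℕ} (h : (A.config O ρ R i).halt = true) :
    A.config O ρ R (i + 1) = A.config O ρ R i := by
  rw [config]; simp [h]

theorem halt_of_le {i j : ℕ} (hij : i ≤ j) (h : (A.config O ρ R i).halt = true) :
    (A.config O ρ R j).halt = true := by
  induction j, hij using Nat.le_induction with
  | base => exact h
  | succ j _ ih => rw [config_succ_of_halt A O ρ R ih]; exact ih

theorem state_succ {i : ℕ} (h : (A.config O ρ R i).halt = false) :
    (A.config O ρ R (i + 1)).state =
      (A.next i ρ (A.config O ρ R i).state ((A.batch O ρ R i).map O)).state := by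
  rw [config]; simp [h, batch]

theorem halt_succ {i : ℕ} (h : (A.config O ρ R i).halt = false) :
    (A.config O ρ R (i + 1)).halt =
      (A.next i ρ (A.config O ρ R i).state ((A.batch O ρ R i).map O)).halt := by
  rw [config]; simp [h, batch]

theorem out_succ (i : ℕ) :
    (A.config O ρ R (i + 1)).out = (A.config O ρ R i).out ++ A.outs O ρ R i := by
  rcases h : (A.config O ρ R i).halt with _ | _
  · rw [config]; simp [h, outs, batch]
  · rw [config_succ_of_halt A O ρ R h]; simp [outs, h]

theorem mem_output_iff {y : α} : y ∈ A.output O ρ R ↔ ∃ i, y ∈ A.outs O ρ R i := by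
  have key : ∀ i, y ∈ (A.config O ρ R i).out ↔ ∃ j < i, y ∈ A.outs O ρ R j := by
    intro i
    induction i with
    | zero => simp [config]
    | succ i ih =>
      rw [out_succ, List.mem_append, ih]
      simp only [Nat.lt_succ_iff_lt_or_eq, or_and_right, exists_or, exists_eq_left]
  constructor
  · rintro ⟨i, hi⟩
    obtain ⟨j, -, hj⟩ := (key i).1 hi
    exact ⟨j, hj⟩
  · rintro ⟨i, hi⟩
    exact ⟨i + 1, (key _).2 ⟨i, Nat.lt_succ_self i, hi⟩⟩

/-- Two executions agree from step `t` on if they are in the same state at that time and if all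
queries receive the same answers. -/
theorem agree_of_agree_answers {A : PROMAlg Q κ α} {O O' : Oracle Q κ} {ρ : Fin A.coins → Bool}
    {R R' : List Bool} {t : ℕ}
    (hs : (A.config O ρ R t).state = (A.config O' ρ R' t).state)
    (hh : (A.config O ρ R t).halt = (A.config O' ρ R' t).halt)
    (H : ∀ j, t ≤ j → (∀ i, t ≤ i → i ≤ j → A.batch O ρ R i = A.batch O' ρ R' i) →
      (∀ i, t ≤ i → i < j → A.outs O ρ R i = A.outs O' ρ R' i) →
      ∀ x ∈ A.batch O ρ R j, O x = O' x) (j : ℕ) (hj : t ≤ j) :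
    A.batch O ρ R j = A.batch O' ρ R' j ∧ A.outs O ρ R j = A.outs O' ρ R' j := by
  have key : ∀ j, t ≤ j → (A.config O ρ R j).state = (A.config O' ρ R' j).state ∧
      (A.config O ρ R j).halt = (A.config O' ρ R' j).halt ∧
      ∀ i, t ≤ i → i < j →
        A.batch O ρ R i = A.batch O' ρ R' i ∧ A.outs O ρ R i = A.outs O' ρ R' i := by
    intro j hj
    induction j, hj using Nat.le_induction with
    | base => exact ⟨hs, hh, fun i h1 h2 => by omega⟩
    | succ j hj ih =>
      obtain ⟨h1, h2, h3⟩ := ih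
      have hb : A.batch O ρ R j = A.batch O' ρ R' j := by rw [batch, batch, h1, h2]
      have hans : (A.batch O ρ R j).map O = (A.batch O' ρ R' j).map O' := by
        rw [← hb]
        refine List.map_congr_left (H j hj (fun i hti hij => ?_) fun i hti hij => (h3 i hti hij).2)
        rcases eq_or_lt_of_le hij with rfl | hij
        · exact hb
        · exact (h3 i hti hij).1
      have ho : A.outs O ρ R j = A.outs O' ρ R' j := by rw [outs, outs, h1, h2, hans]
      have h4 : ∀ i, t ≤ i → i < j + 1 →
          A.batch O ρ R i = A.batch O' ρ R' i ∧ A.outs O ρ R i = A.outs O' ρ R' i := by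
        intro i hti hij
        rcases Nat.lt_succ_iff_lt_or_eq.1 hij with hij | rfl
        · exact h3 i hti hij
        · exact ⟨hb, ho⟩
      rcases h : (A.config O ρ R j).halt with _ | _
      · have h' : (A.config O' ρ R' j).halt = false := by rw [← h2, h]
        rw [state_succ A O ρ R h, halt_succ A O ρ R h, state_succ A O' ρ R' h',
          halt_succ A O' ρ R' h', h1, hans]
        exact ⟨rfl, rfl, h4⟩
      · have h' : (A.config O' ρ R' j).halt = true := by rw [← h2, h]
        rw [config_succ_of_halt A O ρ R h, config_succ_of_halt A O' ρ R' h']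
        exact ⟨h1, h2, h4⟩
  exact (key (j + 1) (by omega)).2.2 j hj (Nat.lt_succ_self j)

end PROMAlg

/-! ### Few oracles admit many needed labels -/

namespace DAG

/-- A hint on `k` needed labels. -/
abbrev Hint (V : Type) (δ κ q' T : ℕ) (X : Finset (BitVec κ)) (k : ℕ) : Type :=
  Fin k → V × UsePlace δ κ q' T X × Option (Fin T × Fin T)

/-- The number of possible values of the hint on one label. -/
def hintCount (V : Type) [Fintype V] (δ q' T q : ℕ) : ℕ :=
  Fintype.card V * ((T * T * δ + q * q') * (T * T + 1))

theorem card_hint {V : Type} [Fintype V] {δ κ q' : ℕ} {X : Finset (BitVec κ)} (T k : ℕ) :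
    Nat.card (Hint V δ κ q' T X k) = hintCount V δ q' T X.card ^ k := by
  rw [Nat.card_eq_fintype_card]
  simp [hintCount, mul_assoc]

theorem card_sigma_vector_le (B : ℕ) :
    Nat.card (Σ i : Fin (B + 1), List.Vector Bool i) ≤ 2 ^ (B + 1) := by
  rw [Nat.card_eq_fintype_card, Fintype.card_sigma]
  simp only [card_vector, Fintype.card_bool]
  rw [Fin.sum_univ_eq_sum_range (fun i => 2 ^ i)]
  have := Nat.geomSum_eq (m := 2) le_rfl (B + 1)
  rw [this]
  simp

variable {V : Type} [Fintype V] [LinearOrder V] (G : DAG V) {δ κ : ℕ} (len q' : ℕ) (ζ : BitVec κ)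
  {X : Finset (BitVec κ)} {A : PROMAlg (Query V δ κ) κ (BitVec κ × BitVec κ)}
  {ρ : Fin A.coins → Bool}

/-- The hint `a` is right for the execution from step `t` on. -/
structure IsHint (O : Oracle (Query V δ κ) κ) (bs : ℕ → List (Query V δ κ))
    (os : ℕ → List (BitVec κ × BitVec κ)) (t : ℕ) {T k : ℕ} (a : Hint V δ κ q' T X k) : Prop where
  inj : Function.Injective fun e => (a e).1
  use : ∀ e, G.IsUse len q' ζ O bs os t (a e).1 (a e).2.1
  first : ∀ e, G.IsFirst len ζ O bs t (a e).1 (a e).2.2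
  out : ∀ i, ∀ p ∈ os i, p.1 ∈ X → p.2 = G.sinkHash len q' ζ O p.1

variable {G len q' ζ} in
theorem IsHint.label_eq (hlen : len ≤ κ) (hq : len * q' ≤ κ) {O O' : Oracle (Query V δ κ) κ}
    {bs bs' : ℕ → List (Query V δ κ)} {os os' : ℕ → List (BitVec κ × BitVec κ)} {t T k : ℕ}
    {a : Hint V δ κ q' T X k} (ha : G.IsHint len q' ζ O bs os t a)
    (ha' : G.IsHint len q' ζ O' bs' os' t a) (hO : ∀ x, O (Sum.inr x) = O' (Sum.inr x))
    (hdiv : ∀ x, (O x).toNat / 2 ^ len = (O' x).toNat / 2 ^ len) {j : ℕ}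
    (hbs : ∀ i, t ≤ i → i ≤ j → bs i = bs' i) (hos : ∀ i, t ≤ i → i < j → os i = os' i)
    (hj : t ≤ j) {e : Fin k} (he : G.properQuery len ζ O (a e).1 ∈ bs j) :
    O (G.properQuery len ζ O (a e).1) = O' (G.properQuery len ζ O (a e).1) := by
  have hlab : G.label len O ζ (a e).1 = G.label len O' ζ (a e).1 := by
    refine G.label_eq_of_isUse len q' ζ hlen hq (ha.use e) (ha'.use e) (fun i hti hc => ?_)
      (fun i hti hc => ?_) ha'.out hO
    · refine hbs i hti ?_
      by_contra hij
      exact hc j hj (by omega) he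
    · refine hos i hti ?_
      by_contra hij
      exact hc j hj (by omega) he
  -- The query contains labels of predecessors not yet known to agree; the place of its first
  -- occurrence identifies it in both executions.
  have hquery : G.properQuery len ζ O (a e).1 = G.properQuery len ζ O' (a e).1 := by
    have h1 := ha.first e
    have h2 := ha'.first e
    rcases hf : (a e).2.2 with _ | ⟨i, m⟩
    · rw [hf] at h1
      exact absurd he (h1 j hj)
    · rw [hf] at h1 h2
      have hij : i.1 ≤ j := by
        by_contra hij
        exact h1.2.1 j hj (by omega) he
      have h3 := h1.2.2
      rw [hbs i h1.1 hij, h2.2.2] at h3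
      exact (Option.some_inj.1 h3).symm
  refine BitVec.eq_of_setWidth_eq_of_div_eq ?_ (hdiv _)
  rw [← G.label_eq, hlab, G.label_eq, ← hquery]

/-- Oracles with the same hint and the same state at time `t` are equal if they differ only in the
low bits of the answers that determine the labels of the hint. -/
theorem oracle_eq_of_isHint (hlen : len ≤ κ) (hq : len * q' ≤ κ) {O O' : Oracle (Query V δ κ) κ}
    {R R' : List Bool} {t T k : ℕ} {a : Hint V δ κ q' T X k}
    (ha : G.IsHint len q' ζ O (A.batch O ρ R) (A.outs O ρ R) t a)
    (ha' : G.IsHint len q' ζ O' (A.batch O' ρ R') (A.outs O' ρ R') t a)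
    (hs : (A.config O ρ R t).state = (A.config O' ρ R' t).state)
    (hh : (A.config O ρ R t).halt = (A.config O' ρ R' t).halt)
    (hdiv : ∀ x, (O x).toNat / 2 ^ len = (O' x).toNat / 2 ^ len)
    (heq : ∀ x, x ∉ Set.range (fun e => G.properQuery len ζ O (a e).1) →
      x ∉ Set.range (fun e => G.properQuery len ζ O' (a e).1) → O x = O' x) : O = O' := by
  -- Queries for labels carry a vertex, so the answers to single strings are never overwritten.
  have hO : ∀ x, O (Sum.inr x) = O' (Sum.inr x) := fun x =>
    heq _ (by rintro ⟨e, he⟩; cases he) (by rintro ⟨e, he⟩; cases he)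
  have hag := PROMAlg.agree_of_agree_answers hs hh (fun j hj hbs hos x hx => by
    by_cases h1 : x ∈ Set.range (fun e => G.properQuery len ζ O (a e).1)
    · obtain ⟨e, rfl⟩ := h1
      exact ha.label_eq hlen hq ha' hO hdiv hbs hos hj hx
    by_cases h2 : x ∈ Set.range (fun e => G.properQuery len ζ O' (a e).1)
    · obtain ⟨e, rfl⟩ := h2
      refine (ha'.label_eq hlen hq ha (fun x => (hO x).symm) (fun x => (hdiv x).symm)
        (fun i h1 h2 => (hbs i h1 h2).symm) (fun i h1 h2 => (hos i h1 h2).symm) hj ?_).symm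
      rw [← hbs j hj le_rfl]; exact hx
    exact heq x h1 h2)
  have hlab_hint : ∀ e, G.label len O ζ (a e).1 = G.label len O' ζ (a e).1 := fun e =>
    G.label_eq_of_isUse len q' ζ hlen hq (ha.use e) (ha'.use e) (fun i hti _ => (hag i hti).1)
      (fun i hti _ => (hag i hti).2) ha'.out hO
  -- Labels of the hint are read off the common execution. The others follow by induction along the
  -- graph, their queries being equal and answered alike.
  have hlab : ∀ v, G.label len O ζ v = G.label len O' ζ v := by
    intro v
    induction v using G.wf.induction with
    | _ v ih =>
      by_cases hv : ∃ e, (a e).1 = v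
      · obtain ⟨e, rfl⟩ := hv
        exact hlab_hint e
      · have hpq := G.properQuery_congr len ζ ih
        rw [G.label_eq, G.label_eq, ← hpq, heq]
        · rintro ⟨e, he⟩; exact hv ⟨e, G.properQuery_inj len ζ he⟩
        · rintro ⟨e, he⟩; exact hv ⟨e, G.properQuery_inj len ζ he⟩
  have hpq : ∀ v, G.properQuery len ζ O v = G.properQuery len ζ O' v := fun v =>
    G.properQuery_congr len ζ fun u _ => hlab u
  funext x
  by_cases h1 : x ∈ Set.range (fun e => G.properQuery len ζ O (a e).1)
  · obtain ⟨e, rfl⟩ := h1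
    refine BitVec.eq_of_setWidth_eq_of_div_eq ?_ (hdiv _)
    rw [← G.label_eq, hlab, G.label_eq]
    exact congrArg (fun y => (O' y).setWidth len) (hpq _).symm
  · refine heq x h1 ?_
    rintro ⟨e, he⟩
    exact h1 ⟨e, by rw [← he]; exact hpq _⟩

theorem exists_isHint {O : Oracle (Query V δ κ) κ} {bs : ℕ → List (Query V δ κ)}
    {os : ℕ → List (BitVec κ × BitVec κ)} {t T k : ℕ}
    (hT : ∀ i, T ≤ i → bs i = []) (hlen : ∀ i, (bs i).length ≤ T)
    (hδ : ∀ v, (G.predList v).length ≤ δ)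
    (hout : ∀ i, ∀ p ∈ os i, p.1 ∈ X → p.2 = G.sinkHash len q' ζ O p.1)
    (hk : k ≤ (G.needed len q' ζ O X bs os t).ncard) :
    ∃ a : Hint V δ κ q' T X k, G.IsHint len q' ζ O bs os t a := by
  classical
  obtain ⟨S, hS, hSk⟩ := Set.exists_subset_card_eq hk
  have hfin : Nat.card S = k := by rw [Nat.card_coe_set_eq, hSk]
  let eqv : Fin k ≃ S := (Finite.equivFinOfCardEq hfin).symm
  choose f hf using fun e : Fin k => G.exists_isUse len q' ζ hT hlen hδ (hS (eqv e).2)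
  choose g hg using fun e : Fin k => G.exists_isFirst len ζ (O := O) t hT hlen (eqv e).1
  exact ⟨fun e => ((eqv e).1, f e, g e),
    fun e e' h => eqv.injective (Subtype.ext h), hf, hg, hout⟩

theorem ncard_isHint_le (hlen : len ≤ κ) (hq : len * q' ≤ κ)
    (R : Oracle (Query V δ κ) κ → List Bool) (t : ℕ) {T k : ℕ} (a : Hint V δ κ q' T X k)
    (st : List Bool) :
    {O | G.IsHint len q' ζ O (A.batch O ρ (R O)) (A.outs O ρ (R O)) t a ∧
      (A.config O ρ (R O) t).state = st ∧
      (A.config O ρ (R O) t).halt = false}.ncard * 2 ^ (len * k) ≤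
      Nat.card (Oracle (Query V δ κ) κ) := by
  refine ncard_mul_two_pow_le hlen _ (fun O e => G.properQuery len ζ O (a e).1) ?_ ?_
  · rintro O ⟨hO, -⟩ e e' h
    exact hO.inj (G.properQuery_inj len ζ h)
  · rintro O ⟨hO, h1, h2⟩ O' ⟨hO', h1', h2'⟩ hdiv heq
    exact G.oracle_eq_of_isHint len q' ζ hlen hq hO hO' (h1.trans h1'.symm) (h2.trans h2'.symm)
      hdiv heq

/-- The oracles for which the algorithm produces no wrong outputs and has a state of at most `B`
bits at time `t` for which at least `k` labels are needed are few. -/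
theorem ncard_needed_le (hlen : len ≤ κ) (hq : len * q' ≤ κ)
    (hδ : ∀ v, (G.predList v).length ≤ δ)
    (R : Oracle (Query V δ κ) κ → List Bool) (t T k B : ℕ)
    (hT : ∀ O i, T ≤ i → A.batch O ρ (R O) i = [])
    (hbatch : ∀ O i, (A.batch O ρ (R O) i).length ≤ T) :
    {O | (∀ i, ∀ p ∈ A.outs O ρ (R O) i, p.1 ∈ X → p.2 = G.sinkHash len q' ζ O p.1) ∧
      (A.config O ρ (R O) t).state.length ≤ B ∧ (A.config O ρ (R O) t).halt = false ∧
      k ≤ (G.needed len q' ζ O X (A.batch O ρ (R O)) (A.outs O ρ (R O)) t).ncard}.ncard *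
        2 ^ (len * k) ≤
      2 ^ (B + 1) * hintCount V δ q' T X.card ^ k * Nat.card (Oracle (Query V δ κ) κ) := by
  classical
  -- Union bound over all states of at most `B` bits and all hints.
  let E : (Σ i : Fin (B + 1), List.Vector Bool i) × Hint V δ κ q' T X k →
      Set (Oracle (Query V δ κ) κ) := fun c =>
    {O | G.IsHint len q' ζ O (A.batch O ρ (R O)) (A.outs O ρ (R O)) t c.2 ∧
      (A.config O ρ (R O) t).state = c.1.2.1 ∧ (A.config O ρ (R O) t).halt = false}
  have hsub : {O | (∀ i, ∀ p ∈ A.outs O ρ (R O) i, p.1 ∈ X → p.2 = G.sinkHash len q' ζ O p.1) ∧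
      (A.config O ρ (R O) t).state.length ≤ B ∧ (A.config O ρ (R O) t).halt = false ∧
      k ≤ (G.needed len q' ζ O X (A.batch O ρ (R O)) (A.outs O ρ (R O)) t).ncard} ⊆
      ⋃ c ∈ (Finset.univ : Finset ((Σ i : Fin (B + 1), List.Vector Bool i) ×
        Hint V δ κ q' T X k)), E c := by
    rintro O ⟨h1, h2, h3, h4⟩
    obtain ⟨a, ha⟩ := G.exists_isHint len q' ζ (hT O) (hbatch O) hδ h1 h4
    simp only [Finset.mem_univ, Set.iUnion_true, Set.mem_iUnion]
    exact ⟨(⟨⟨_, Nat.lt_succ_of_le h2⟩, ⟨(A.config O ρ (R O) t).state, rfl⟩⟩, a), ha, rfl, h3⟩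
  have h1 := (Set.ncard_le_ncard hsub (Set.toFinite _)).trans
    (Finset.set_ncard_biUnion_le Finset.univ E)
  calc _ ≤ (∑ c, (E c).ncard) * 2 ^ (len * k) := Nat.mul_le_mul_right _ h1
    _ = ∑ c, (E c).ncard * 2 ^ (len * k) := Finset.sum_mul _ _ _
    _ ≤ ∑ c : (Σ i : Fin (B + 1), List.Vector Bool i) × Hint V δ κ q' T X k,
        Nat.card (Oracle (Query V δ κ) κ) :=
      Finset.sum_le_sum fun c _ => G.ncard_isHint_le len q' ζ hlen hq R t c.2 _
    _ = Nat.card (Σ i : Fin (B + 1), List.Vector Bool i) * Nat.card (Hint V δ κ q' T X k) *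
        Nat.card (Oracle (Query V δ κ) κ) := by
      rw [Finset.sum_const, smul_eq_mul, ← Nat.card_prod, Finset.card_univ,
        Nat.card_eq_fintype_card (α := _ × _)]
    _ ≤ _ := by
      rw [card_hint]
      gcongr
      exact card_sigma_vector_le B

end DAG

/-! ### Sampling indices -/

/-- Each residue occurs at most `L / h + 1 ≤ 2 * (L / h)` times. The bias of the reduction modulo
`h` thus costs a factor 2, which is why `S` may fill only a quarter of the residues. -/
theorem card_filter_mod_mem_le {L h : ℕ} (hh : 0 < h) (hL : h ≤ L) (S : Finset ℕ)
    (hS : 4 * S.card ≤ h) : ((Finset.range L).filter fun a => a % h ∈ S).card * 2 ≤ L := by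
  have h1 : ((Finset.range L).filter fun a => a % h ∈ S).card ≤
      (S ×ˢ Finset.range (L / h + 1)).card := by
    refine Finset.card_le_card_of_injOn (fun a => (a % h, a / h)) (fun a ha => ?_) ?_
    · simp only [Finset.coe_filter, Finset.mem_range, Set.mem_ofPred_eq] at ha
      simp only [Finset.coe_product, Set.mem_prod, Finset.mem_coe, Finset.mem_range]
      exact ⟨ha.2, Nat.lt_succ_of_le (Nat.div_le_div_right ha.1.le)⟩
    · intro a _ b _ hab
      simp only [Prod.mk.injEq] at hab
      rw [← Nat.div_add_mod a h, ← Nat.div_add_mod b h, hab.1, hab.2]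
  rw [Finset.card_product, Finset.card_range] at h1
  have h2 : 1 ≤ L / h := Nat.div_pos hL hh
  calc _ ≤ S.card * (L / h + 1) * 2 := Nat.mul_le_mul_right _ h1
    _ ≤ S.card * (L / h + L / h) * 2 := by gcongr
    _ = 4 * S.card * (L / h) := by ring
    _ ≤ h * (L / h) := Nat.mul_le_mul_right _ hS
    _ ≤ L := Nat.mul_div_le L h

theorem card_filter_digits_le {len : ℕ} (T : Finset ℕ) (q d : ℕ) :
    ((Finset.range (2 ^ (len * q + d))).filter
      fun n => ∀ m < q, n / 2 ^ (len * m) % 2 ^ len ∈ T).card ≤ T.card ^ q * 2 ^ d := by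
  induction q with
  | zero => simp
  | succ q ih =>
    refine le_trans (Finset.card_le_card_of_injOn (t := T ×ˢ ((Finset.range (2 ^ (len * q + d))).filter
      fun n => ∀ m < q, n / 2 ^ (len * m) % 2 ^ len ∈ T))
      (fun n => (n % 2 ^ len, n / 2 ^ len)) (fun n hn => ?_) ?_) ?_
    · simp only [Finset.coe_filter, Finset.mem_range, Set.mem_ofPred_eq] at hn
      simp only [Finset.coe_product, Set.mem_prod, Finset.mem_coe, Finset.mem_filter,
        Finset.mem_range]
      refine ⟨by simpa using hn.2 0 (by omega), ?_, fun m hm => ?_⟩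
      · rw [Nat.div_lt_iff_lt_mul (by positivity), ← pow_add]
        convert hn.1 using 2
        ring
      · have := hn.2 (m + 1) (by omega)
        rwa [Nat.mul_succ, Nat.add_comm, pow_add, ← Nat.div_div_eq_div_mul] at this
    · intro a _ b _ hab
      simp only [Prod.mk.injEq] at hab
      rw [← Nat.div_add_mod a (2 ^ len), ← Nat.div_add_mod b (2 ^ len), hab.1, hab.2]
    · rw [Finset.card_product, pow_succ, mul_comm (T.card ^ q), mul_assoc]
      exact Nat.mul_le_mul_left _ ih

theorem ncard_sampleIndex_mem_le {κ len q' h : ℕ} (hq : len * q' ≤ κ) (hh : 0 < h)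
    (hL : h ≤ 2 ^ len) (S : Finset ℕ) (hS : 4 * S.card ≤ h) :
    {r : BitVec κ | ∀ m < q', sampleIndex len h r m ∈ S}.ncard * 2 ^ q' ≤ 2 ^ κ := by
  obtain ⟨d, rfl⟩ := Nat.exists_eq_add_of_le hq
  let T := (Finset.range (2 ^ len)).filter fun a => a % h ∈ S
  have h1 : {r : BitVec (len * q' + d) | ∀ m < q', sampleIndex len h r m ∈ S}.ncard ≤
      T.card ^ q' * 2 ^ d := by
    refine le_trans ?_ (card_filter_digits_le (len := len) T q' d)
    rw [← Set.ncard_coe_finset]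
    refine Set.ncard_le_ncard_of_injOn BitVec.toNat (fun r hr => ?_)
      (fun a _ b _ hab => BitVec.eq_of_toNat_eq hab) (Set.toFinite _)
    simp only [Finset.coe_filter, Finset.mem_range, Set.mem_ofPred_eq, T, Finset.mem_filter]
    exact ⟨r.isLt, fun m hm => ⟨Nat.mod_lt _ (by positivity), hr m hm⟩⟩
  calc _ ≤ T.card ^ q' * 2 ^ d * 2 ^ q' := Nat.mul_le_mul_right _ h1
    _ = (T.card * 2) ^ q' * 2 ^ d := by rw [mul_pow]; ring
    _ ≤ (2 ^ len) ^ q' * 2 ^ d := by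
      gcongr
      exact card_filter_mod_mem_le hh hL S hS
    _ = 2 ^ (len * q' + d) := by rw [pow_add, pow_mul]

theorem BitVec.natCard (κ : ℕ) : Nat.card (BitVec κ) = 2 ^ κ :=
  Nat.card_eq_of_equiv_fin BitVec.equivFin.toEquiv

/-- Oracles whose answers at the places in `X` lie in a set of density `1 / c` are few. -/
theorem ncard_forall_mem_le {Q : Type} [Finite Q] {κ c : ℕ} (X : Finset Q) (B : Set (BitVec κ))
    (hB : B.ncard * c ≤ 2 ^ κ) :
    {O : Oracle Q κ | ∀ x ∈ X, O x ∈ B}.ncard * c ^ X.card ≤ Nat.card (Oracle Q κ) := by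
  classical
  have := Fintype.ofFinite Q
  have : Fintype (BitVec κ) := Fintype.ofFinite _
  have h1 : {O : Oracle Q κ | ∀ x ∈ X, O x ∈ B} =
      (Fintype.piFinset fun x => if x ∈ X then B.toFinset else Finset.univ : Finset (Oracle Q κ)) := by
    ext O
    simp only [Set.mem_ofPred_eq, Finset.mem_coe, Fintype.mem_piFinset]
    refine forall_congr' fun x => ?_
    by_cases hx : x ∈ X <;> simp [hx]
  have h2 : c ^ X.card = ∏ x : Q, if x ∈ X then c else 1 := by
    rw [Finset.prod_ite_mem, Finset.univ_inter, Finset.prod_const]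
  rw [h1, Set.ncard_coe_finset, Fintype.card_piFinset, h2, ← Finset.prod_mul_distrib]
  have h3 : Nat.card (Oracle Q κ) = ∏ _x : Q, 2 ^ κ := by
    rw [Finset.prod_const, Nat.card_fun, BitVec.natCard, Finset.card_univ, Nat.card_eq_fintype_card]
  rw [h3]
  refine Finset.prod_le_prod' fun x _ => ?_
  by_cases hx : x ∈ X
  · simp only [hx, if_true]
    rwa [← Set.ncard_eq_toFinset_card']
  · simp only [hx, if_false, mul_one, Finset.card_univ]
    rw [← Nat.card_eq_fintype_card, BitVec.natCard]

/-- The indices that are drawn in the evaluation of the hash function at the places in `X`. -/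
def sampledIndices {V : Type} {δ κ : ℕ} (len q' z : ℕ) (X : Finset (BitVec κ))
    (O : Oracle (Query V δ κ) κ) : Finset ℕ :=
  (X ×ˢ Finset.range q').image fun p => sampleIndex len z (O (Sum.inr p.1)) p.2

/-- If fewer than `s` indices are drawn, all `q' * |X|` draws fall into one set of size `s`. For a
fixed set this has probability at most `2 ^ (-q' * |X|)`, and there are at most `h ^ s` sets. -/
theorem ncard_card_sampledIndices_lt_le {V : Type} [Finite V] {δ κ len q' h s : ℕ}
    (hq : len * q' ≤ κ) (hh : 0 < h) (hL : h ≤ 2 ^ len) (hs : 4 * s ≤ h) (X : Finset (BitVec κ)) :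
    {O : Oracle (Query V δ κ) κ | (sampledIndices len q' h X O).card < s}.ncard *
      2 ^ (q' * X.card) ≤ h ^ s * Nat.card (Oracle (Query V δ κ) κ) := by
  classical
  let E : Finset ℕ → Set (Oracle (Query V δ κ) κ) := fun S =>
    {O | ∀ x ∈ X.map ⟨Sum.inr, Sum.inr_injective⟩,
      O x ∈ {r : BitVec κ | ∀ m < q', sampleIndex len h r m ∈ S}}
  have hsub : {O : Oracle (Query V δ κ) κ | (sampledIndices len q' h X O).card < s} ⊆
      ⋃ S ∈ (Finset.range h).powersetCard s, E S := by
    intro O hO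
    have hI : sampledIndices len q' h X O ⊆ Finset.range h := by
      intro i hi
      obtain ⟨p, -, rfl⟩ := Finset.mem_image.1 hi
      exact Finset.mem_range.2 (Nat.mod_lt _ hh)
    obtain ⟨S, h1, h2, h3⟩ := Finset.exists_subsuperset_card_eq hI (le_of_lt hO)
      (by rw [Finset.card_range]; omega)
    simp only [Set.mem_iUnion]
    refine ⟨S, Finset.mem_powersetCard.2 ⟨h2, h3⟩, ?_⟩
    intro x hx m hm
    obtain ⟨y, hy, rfl⟩ := Finset.mem_map.1 hx
    exact h1 (Finset.mem_image.2 ⟨(y, m), by simp [hy, hm], rfl⟩)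
  calc _ ≤ (∑ S ∈ (Finset.range h).powersetCard s, (E S).ncard) * 2 ^ (q' * X.card) :=
      Nat.mul_le_mul_right _ ((Set.ncard_le_ncard hsub (Set.toFinite _)).trans
        (Finset.set_ncard_biUnion_le _ E))
    _ = ∑ S ∈ (Finset.range h).powersetCard s, (E S).ncard * 2 ^ (q' * X.card) :=
      Finset.sum_mul _ _ _
    _ ≤ ∑ S ∈ (Finset.range h).powersetCard s, Nat.card (Oracle (Query V δ κ) κ) := by
      refine Finset.sum_le_sum fun S hS => ?_
      have := ncard_forall_mem_le (X.map ⟨Sum.inr, Sum.inr_injective⟩)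
        {r : BitVec κ | ∀ m < q', sampleIndex len h r m ∈ S}
        (ncard_sampleIndex_mem_le hq hh hL S (by rw [(Finset.mem_powersetCard.1 hS).2]; exact hs))
        (Q := Query V δ κ)
      rwa [Finset.card_map, ← pow_mul] at this
    _ ≤ _ := by
      rw [Finset.sum_const, smul_eq_mul, Finset.card_powersetCard, Finset.card_range]
      exact Nat.mul_le_mul_right _ (Nat.choose_le_pow h s)

theorem DAG.card_sampledIndices_le {V : Type} [Fintype V] [LinearOrder V] (G : DAG V) {δ κ : ℕ}
    (len q' : ℕ) (X : Finset (BitVec κ)) (O : Oracle (Query V δ κ) κ) (hG : G.sinkList ≠ []) :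
    (sampledIndices len q' G.sinkList.length X O).card ≤
      {v | ∃ x ∈ X, ∃ m < q', G.LooksUp len O x m v}.ncard := by
  classical
  have hpos : 0 < G.sinkList.length := List.length_pos_of_ne_nil hG
  rw [← Set.ncard_coe_finset]
  have hlt : ∀ i ∈ sampledIndices len q' G.sinkList.length X O, i < G.sinkList.length := by
    intro i hi
    obtain ⟨p, -, rfl⟩ := Finset.mem_image.1 hi
    exact Nat.mod_lt _ hpos
  have hne : Nonempty V := ⟨G.sinkList[0]⟩
  refine Set.ncard_le_ncard_of_injOn (fun i => G.sinkList[i]?.getD (Classical.choice hne))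
    (fun i hi => ?_) (fun i hi j hj hij => ?_) (Set.toFinite _)
  · have hi' := hlt i hi
    obtain ⟨p, hp, rfl⟩ := Finset.mem_image.1 hi
    rw [Finset.mem_product, Finset.mem_range] at hp
    refine ⟨p.1, hp.1, p.2, hp.2, ?_⟩
    rw [LooksUp, List.getElem?_eq_getElem hi', Option.getD_some]
  · have hi' := hlt i hi
    have hj' := hlt j hj
    simp only [List.getElem?_eq_getElem hi', List.getElem?_eq_getElem hj', Option.getD_some] at hij
    exact ((Finset.sort_nodup _ _).getElem_inj_iff).1 hij

/-! ### Sinks and predecessors in the cylinder -/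

namespace CylVertex

variable {h : ℕ}

theorem isSink_iff {v : CylVertex h} :
    (∀ w, ¬ (cylinder h).Adj v w) ↔ v.level + 1 = 2 * h := by
  constructor
  · intro hv
    by_contra hne
    have := v.level_lt
    obtain ⟨w, hw, hc⟩ := exists_level_col (h := h) (l := v.level + 1) (by omega) v.col
    exact hv w (adj_iff.2 ⟨hw, .inl hc⟩)
  · intro hv w hw
    have := (adj_iff.1 hw).1
    have := w.level_lt
    omega

theorem level_of_mem_sinkList {v : CylVertex h} (hv : v ∈ (cylinder h).sinkList) :
    v.level + 1 = 2 * h := by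
  classical
  exact isSink_iff.1 (by simpa [DAG.sinkList] using hv)

theorem length_sinkList (hh : 0 < h) : (cylinder h).sinkList.length = h := by
  classical
  rw [DAG.sinkList, Finset.length_sort]
  conv_rhs => rw [← Finset.card_range h]
  refine Finset.card_nbij CylVertex.pos (fun v hv => ?_) (fun u hu v hv huv => ?_) (fun j hj => ?_)
  · exact Finset.mem_range.2 v.pos_lt
  · simp only [Finset.coe_filter, Finset.mem_univ, true_and, Set.mem_ofPred_eq, isSink_iff] at hu hv
    exact ext_level_pos (by omega) huv
  · refine ⟨toLex (⟨2 * h - 1, by omega⟩, ⟨j, by simpa using hj⟩), ?_, rfl⟩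
    simp only [Finset.coe_filter, Finset.mem_univ, true_and, Set.mem_ofPred_eq, isSink_iff]
    show 2 * h - 1 + 1 = 2 * h
    omega

theorem length_predList_le (v : CylVertex h) : ((cylinder h).predList v).length ≤ 2 := by
  classical
  rw [DAG.predList, Finset.length_sort]
  refine le_trans (Finset.card_le_card_of_injOn (t := {v.col, v.col - 1}) col (fun u hu => ?_)
    (fun u hu w hw huw => ?_)) Finset.card_le_two
  · simp only [Finset.coe_filter, Finset.mem_univ, true_and, Set.mem_ofPred_eq, adj_iff] at hu
    simp only [Finset.coe_insert, Finset.coe_singleton, Set.mem_insert_iff, Set.mem_singleton_iff]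
    rcases hu.2 with h1 | h1 <;> simp [h1]
  · simp only [Finset.coe_filter, Finset.mem_univ, true_and, Set.mem_ofPred_eq, adj_iff] at hu hw
    exact ext_level_pos (by omega) (pos_eq_iff_col_eq.2 huw)

end CylVertex

/-! ### The probability of success -/

/-- Averaging over the coins reduces the problem to deterministic algorithms. -/
theorem unifProb_prod_le {Ω C : Type} [Finite Ω] [Nonempty Ω] [Finite C] [Nonempty C]
    {E : Set (Ω × C)} {b : ℝ} (h : ∀ c, ({ω | (ω, c) ∈ E}.ncard : ℝ) ≤ b * Nat.card Ω) :
    unifProb E ≤ b := by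
  classical
  have := Fintype.ofFinite C
  have hΩ : 0 < Nat.card Ω := Nat.card_pos
  have hC : 0 < Nat.card C := Nat.card_pos
  have hsub : E ⊆ ⋃ c ∈ (Finset.univ : Finset C), (fun ω => (ω, c)) '' {ω | (ω, c) ∈ E} := by
    rintro ⟨ω, c⟩ hω
    simp only [Finset.mem_univ, Set.iUnion_true, Set.mem_iUnion]
    exact ⟨c, ω, hω, rfl⟩
  have h1 : E.ncard ≤ ∑ c : C, {ω | (ω, c) ∈ E}.ncard :=
    (Set.ncard_le_ncard hsub (Set.toFinite _)).trans
      ((Finset.set_ncard_biUnion_le _ _).trans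
        (Finset.sum_le_sum fun c _ => Set.ncard_image_le (Set.toFinite _)))
  have h2 : (E.ncard : ℝ) ≤ Nat.card C * (b * Nat.card Ω) := by
    calc (E.ncard : ℝ) ≤ ∑ c : C, ({ω | (ω, c) ∈ E}.ncard : ℝ) := by exact_mod_cast h1
      _ ≤ ∑ _c : C, b * Nat.card Ω := Finset.sum_le_sum fun c _ => h c
      _ = _ := by rw [Finset.sum_const, Finset.card_univ, nsmul_eq_mul,
          Nat.card_eq_fintype_card (α := C)]
  rw [unifProb, Nat.card_coe_set_eq, Nat.card_prod, div_le_iff₀ (by exact_mod_cast Nat.mul_pos hΩ hC)]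
  push_cast
  linarith

section Success

variable {h κ len q' : ℕ} {ζ : BitVec κ} {X : Finset (BitVec κ)}
  {A : PROMAlg (Query (CylVertex h) 2 κ) κ (BitVec κ × BitVec κ)} {ρ : Fin A.coins → Bool}
  {T k k₀ : ℕ} {Λ : ℝ}

theorem PROMAlg.batch_eq_nil {Q : Type} {κ : ℕ} {α : Type} {A : PROMAlg Q κ α} {O : Oracle Q κ}
    {ρ : Fin A.coins → Bool} {R : List Bool} {t : ℕ} (ht : (A.config O ρ R t).halt = true) (i : ℕ)
    (hi : t ≤ i) : A.batch O ρ R i = [] := by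
  rw [batch, halt_of_le A O ρ R hi ht, if_pos rfl]

theorem PROMAlg.outs_eq_nil {Q : Type} {κ : ℕ} {α : Type} {A : PROMAlg Q κ α} {O : Oracle Q κ}
    {ρ : Fin A.coins → Bool} {R : List Bool} {t : ℕ} (ht : (A.config O ρ R t).halt = true) (i : ℕ)
    (hi : t ≤ i) : A.outs O ρ R i = [] := by
  rw [outs, halt_of_le A O ρ R hi ht, if_pos rfl]

/-- An execution that produces the right outputs with few time-steps of high memory has, at some
time-step of low memory or in the beginning, many needed labels, or few sinks are looked up. -/
theorem false_of_few_needed {O : Oracle (Query (CylVertex h) 2 κ) κ} {R : List Bool}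
    (hout : A.output O ρ R =
      (fun x => (x, (cylinder h).sinkHash len q' ζ O x)) '' (X : Set (BitVec κ)))
    (hsus : A.sustainedMem Λ O ρ R < h) (hR : (R.length : ℝ) < Λ)
    (hT : (A.config O ρ R T).halt = true) (hk : 2 * (k - 1) ≤ h)
    (hlow : ∀ t, (A.config O ρ R t).halt = false → ((A.config O ρ R t).state.length : ℝ) < Λ →
      ((cylinder h).needed len q' ζ O X (A.batch O ρ R) (A.outs O ρ R) t).ncard < k)
    (h0 : ((cylinder h).needed len q' ζ O X (A.batch O ρ R) (A.outs O ρ R) 0).ncard < k₀)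
    (hD : k₀ ≤ {v | ∃ x ∈ X, ∃ m < q', (cylinder h).LooksUp len O x m v}.ncard) : False := by
  have hset : {i | ¬ ((A.config O ρ R i).halt = true ∨
      ((A.config O ρ R i).state.length : ℝ) < Λ)} = {i : ℕ | (A.config O ρ R i).halt = false ∧
      Λ ≤ ((A.config O ρ R i).state.length : ℝ)} := by
    ext i; simp
  have hleg : CylVertex.IsPebbling
      ((cylinder h).needed len q' ζ O X (A.batch O ρ R) (A.outs O ρ R)) :=
    fun t v hv => (cylinder h).needed_succ len q' ζ hv
  obtain ⟨v, ⟨x, hx, m, hm, hv⟩, hnever⟩ := hleg.exists_never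
    (low := fun i => (A.config O ρ R i).halt = true ∨ ((A.config O ρ R i).state.length : ℝ) < Λ)
    (.inr hR) (by
      refine (Set.finite_lt_nat T).subset fun i hi => ?_
      by_contra hTi
      exact hi (.inl (A.halt_of_le O ρ R (not_lt.1 hTi) hT)))
    (by rw [hset]; exact hsus)
    (fun t ht => by
      by_cases hh : (A.config O ρ R t).halt = true
      · have : (cylinder h).needed len q' ζ O X (A.batch O ρ R) (A.outs O ρ R) t = ∅ := by
          rw [Set.eq_empty_iff_forall_notMem]
          rintro v ⟨i, hti, -, ⟨w, -, hw⟩ | ⟨-, x, -, hx, -⟩⟩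
          · rw [DAG.Computed, PROMAlg.batch_eq_nil hh i hti] at hw
            simp at hw
          · rw [PROMAlg.outs_eq_nil hh i hti] at hx
            simp at hx
        rw [this, Set.ncard_empty]
        omega
      · have := hlow t (by simpa using hh) (ht.resolve_left hh)
        omega)
    (D := {v | ∃ x ∈ X, ∃ m < q', (cylinder h).LooksUp len O x m v})
    (by
      rintro v ⟨x, -, m, -, hv⟩
      exact CylVertex.level_of_mem_sinkList (List.mem_of_getElem? hv))
    (h0.trans_le hD)
  have hmem : (x, (cylinder h).sinkHash len q' ζ O x) ∈ A.output O ρ R := by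
    rw [hout]; exact ⟨x, hx, rfl⟩
  obtain ⟨i, hi⟩ := (A.mem_output_iff O ρ R).1 hmem
  obtain ⟨h1, u, hadj, hu⟩ := hnever i
  rcases (cylinder h).mem_needed_of_mem_output len q' ζ hx hi hm hv with h2 | h2
  · exact h1 h2
  · exact hu (h2 u hadj)

theorem cast_le_of_mul_two_pow_le {a N M len k B : ℕ} {b : ℝ} (hb : (B : ℝ) ≤ b)
    (h : a * 2 ^ (len * k) ≤ 2 ^ (B + 1) * M ^ k * N) :
    (a : ℝ) ≤ 2 * (2 : ℝ) ^ b * (M / 2 ^ len) ^ k * N := by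
  have h1 : (a : ℝ) * 2 ^ (len * k) ≤ 2 ^ (B + 1) * M ^ k * N := by exact_mod_cast h
  have h2 : (2 : ℝ) ^ (B + 1) ≤ 2 * (2 : ℝ) ^ b := by
    rw [pow_succ, mul_comm, ← Real.rpow_natCast]
    gcongr
    norm_num
  rw [div_pow, ← pow_mul, mul_div_assoc', div_mul_eq_mul_div, le_div_iff₀ (by positivity)]
  refine h1.trans ?_
  gcongr

/-- The probability that an algorithm whose initial state has at most `b₀` bits produces the right
outputs with fewer than `h` time-steps of high memory. -/
theorem unifProb_success_le (hlen : len ≤ κ) (hq : len * q' ≤ κ)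
    (R : Oracle (Query (CylVertex h) 2 κ) κ → List Bool)
    (hT : ∀ O ρ, (A.config O ρ (R O) T).halt = true)
    (hbatch : ∀ O ρ i, (A.batch O ρ (R O) i).length ≤ T) (hk : 2 * (k - 1) ≤ h)
    (hΛ : 0 ≤ Λ) {b₀ p : ℝ} (hb₀ : 0 ≤ b₀) (hbΛ : b₀ < Λ)
    (hR : ∀ O, ((R O).length : ℝ) ≤ b₀)
    (hp : ({O : Oracle (Query (CylVertex h) 2 κ) κ | {v | ∃ x ∈ X, ∃ m < q',
      (cylinder h).LooksUp len O x m v}.ncard < k₀}.ncard : ℝ) ≤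
        p * Nat.card (Oracle (Query (CylVertex h) 2 κ) κ)) :
    unifProb {ω : Oracle (Query (CylVertex h) 2 κ) κ × (Fin A.coins → Bool) |
      A.output ω.1 ω.2 (R ω.1) =
        (fun x => (x, (cylinder h).sinkHash len q' ζ ω.1 x)) '' (X : Set (BitVec κ)) ∧
      A.sustainedMem Λ ω.1 ω.2 (R ω.1) < h} ≤
    T * (2 * (2 : ℝ) ^ Λ * (DAG.hintCount (CylVertex h) 2 q' T X.card / 2 ^ len) ^ k) +
      2 * (2 : ℝ) ^ b₀ * (DAG.hintCount (CylVertex h) 2 q' T X.card / 2 ^ len) ^ k₀ + p := by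
  have : Nonempty (Oracle (Query (CylVertex h) 2 κ) κ) := ⟨fun _ => 0⟩
  refine unifProb_prod_le fun ρ => ?_
  let Bad : ℕ → ℕ → ℕ → Set (Oracle (Query (CylVertex h) 2 κ) κ) := fun t k B =>
    {O | (∀ i, ∀ p ∈ A.outs O ρ (R O) i, p.1 ∈ X →
        p.2 = (cylinder h).sinkHash len q' ζ O p.1) ∧
      (A.config O ρ (R O) t).state.length ≤ B ∧ (A.config O ρ (R O) t).halt = false ∧
      k ≤ ((cylinder h).needed len q' ζ O X (A.batch O ρ (R O)) (A.outs O ρ (R O)) t).ncard}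
  have hBad : ∀ t k B, (Bad t k B).ncard * 2 ^ (len * k) ≤
      2 ^ (B + 1) * DAG.hintCount (CylVertex h) 2 q' T X.card ^ k *
        Nat.card (Oracle (Query (CylVertex h) 2 κ) κ) := fun t k B =>
    (cylinder h).ncard_needed_le len q' ζ hlen hq CylVertex.length_predList_le R t T k B
      (fun O i hi => PROMAlg.batch_eq_nil (hT O ρ) i hi) (fun O i => hbatch O ρ i)
  have hsub : {O | A.output O ρ (R O) =
        (fun x => (x, (cylinder h).sinkHash len q' ζ O x)) '' (X : Set (BitVec κ)) ∧
      A.sustainedMem Λ O ρ (R O) < h} ⊆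
      ((⋃ t ∈ Finset.range T, Bad t k ⌊Λ⌋₊) ∪ Bad 0 k₀ ⌊b₀⌋₊) ∪
      {O | {v | ∃ x ∈ X, ∃ m < q', (cylinder h).LooksUp len O x m v}.ncard < k₀} := by
    rintro O ⟨h1, h2⟩
    have houts : ∀ i, ∀ p ∈ A.outs O ρ (R O) i, p.1 ∈ X →
        p.2 = (cylinder h).sinkHash len q' ζ O p.1 := by
      intro i p hp _
      have : p ∈ A.output O ρ (R O) := (A.mem_output_iff O ρ (R O)).2 ⟨i, hp⟩
      rw [h1] at this
      obtain ⟨x, -, rfl⟩ := this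
      rfl
    by_contra hO
    simp only [Set.mem_union, Set.mem_iUnion, not_or, not_exists] at hO
    obtain ⟨⟨hA, hB⟩, hC⟩ := hO
    refine false_of_few_needed (k := k) (k₀ := k₀) h1 h2 ((hR O).trans_lt hbΛ) (hT O ρ) hk
      (fun t ht hlt => ?_) ?_ (not_lt.1 hC)
    · by_contra hcard
      refine hA t (Finset.mem_range.2 ?_) ⟨houts, Nat.le_floor hlt.le, ht, not_lt.1 hcard⟩
      by_contra hTt
      rw [A.halt_of_le O ρ (R O) (not_lt.1 hTt) (hT O ρ)] at ht
      cases ht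
    · by_contra hcard
      exact hB ⟨houts, Nat.le_floor (hR O), rfl, not_lt.1 hcard⟩
  have hncard := (Set.ncard_le_ncard hsub (Set.toFinite _)).trans
    ((Set.ncard_union_le _ _).trans (Nat.add_le_add_right ((Set.ncard_union_le _ _).trans
      (Nat.add_le_add_right (Finset.set_ncard_biUnion_le _ _) _)) _))
  refine (Nat.cast_le (α := ℝ).2 hncard).trans ?_
  push_cast
  have h1 : ∀ t, ((Bad t k ⌊Λ⌋₊).ncard : ℝ) ≤ _ := fun t =>
    cast_le_of_mul_two_pow_le (Nat.floor_le hΛ) (hBad t k ⌊Λ⌋₊)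
  have h2 := cast_le_of_mul_two_pow_le (Nat.floor_le hb₀) (hBad 0 k₀ ⌊b₀⌋₊)
  have h3 := Finset.sum_le_card_nsmul (Finset.range T) _ _ fun t _ => h1 t
  rw [Finset.card_range, nsmul_eq_mul] at h3
  rw [add_mul, add_mul]
  refine add_le_add (add_le_add ?_ h2) hp
  rw [mul_assoc]
  exact h3

end Success

/-! ### Choice of the parameters and asymptotic estimates -/

section Bounds

/-- The bound on the success probability for concrete parameters. -/
theorem unifProb_success_le_of_params {h κ len q' T : ℕ} {ζ : BitVec κ} {X : Finset (BitVec κ)}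
    {A : PROMAlg (Query (CylVertex h) 2 κ) κ (BitVec κ × BitVec κ)} {Λ Δ M : ℝ}
    (hq'0 : 0 < q') (hlen0 : 0 < len) (hlen : len ≤ κ) (hq : len * q' ≤ κ)
    (R : Oracle (Query (CylVertex h) 2 κ) κ → List Bool)
    (hT : ∀ O ρ, (A.config O ρ (R O) T).halt = true)
    (hbatch : ∀ O ρ i, (A.batch O ρ (R O) i).length ≤ T)
    (hΔ : 0 < Δ) (hR : ∀ O, ((R O).length : ℝ) ≤ Λ - Δ) (hX : X.card = ⌈Λ / len⌉₊)
    (hΛh : Λ / len ≤ h / 32) (hM : (DAG.hintCount (CylVertex h) 2 q' T X.card : ℝ) ≤ M)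
    (hMlen : M ≤ (2 : ℝ) ^ ((len : ℝ) / 4)) (hhlen : h ≤ 2 ^ len)
    (hh : (len : ℝ) < Λ → (h : ℝ) ^ 4 ≤ 2 ^ q') :
    unifProb {ω : Oracle (Query (CylVertex h) 2 κ) κ × (Fin A.coins → Bool) |
      A.output ω.1 ω.2 (R ω.1) =
        (fun x => (x, (cylinder h).sinkHash len q' ζ ω.1 x)) '' (X : Set (BitVec κ)) ∧
      A.sustainedMem Λ ω.1 ω.2 (R ω.1) < h} ≤
    T * (2 / (2 : ℝ) ^ ((len : ℝ) / 4)) + (2 / (2 : ℝ) ^ ((len : ℝ) / 4) + 2 * M / (2 : ℝ) ^ Δ) +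
      if (len : ℝ) < Λ then 1 / (2 : ℝ) ^ ((q' : ℝ) / 2) else 0 := by
  have hb₀ : 0 ≤ Λ - Δ := (Nat.cast_nonneg _).trans (hR fun _ => 0)
  have hΛ : 0 < Λ := by linarith
  have hl : (0 : ℝ) < len := by exact_mod_cast hlen0
  have hx : 0 < Λ / len := by positivity
  have hhpos : 0 < h := by
    have : (0 : ℝ) < h := by linarith
    exact_mod_cast this
  set m : ℝ := (DAG.hintCount (CylVertex h) 2 q' T X.card : ℝ) with hm
  have hm0 : 0 ≤ m := Nat.cast_nonneg _
  have hM0 : 0 ≤ M := hm0.trans hM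
  -- The hint on a label costs at most `len / 4` bits, so each needed label saves `3 / 4 * len`
  -- bits.
  have hbase : m / 2 ^ len ≤ (2 : ℝ) ^ (-(3 / 4 * (len : ℝ))) := by
    rw [div_le_iff₀ (by positivity), ← Real.rpow_natCast, ← Real.rpow_add (by norm_num)]
    refine (hM.trans hMlen).trans (le_of_eq ?_)
    congr 1; ring
  -- Since `Λ ≤ k * len / 2`, the exponent `Λ - 3 / 4 * len * k` is at most `-k * len / 4`.
  have hkey : ∀ k : ℕ, 2 * Λ / len ≤ k → 0 < k →
      2 * (2 : ℝ) ^ Λ * (m / 2 ^ len) ^ k ≤ 2 / (2 : ℝ) ^ ((len : ℝ) / 4) := by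
    intro k hk hk0
    rw [div_le_iff₀ hl] at hk
    have hk1 : (1 : ℝ) ≤ k := by exact_mod_cast hk0
    calc 2 * (2 : ℝ) ^ Λ * (m / 2 ^ len) ^ k
        ≤ 2 * (2 : ℝ) ^ Λ * ((2 : ℝ) ^ (-(3 / 4 * (len : ℝ)))) ^ k := by gcongr
      _ = 2 * (2 : ℝ) ^ (Λ + -(3 / 4 * (len : ℝ)) * k) := by
        rw [← Real.rpow_natCast, ← Real.rpow_mul (by norm_num), mul_assoc,
          ← Real.rpow_add (by norm_num)]
      _ ≤ 2 * (2 : ℝ) ^ (-((len : ℝ) / 4)) := by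
        gcongr
        · norm_num
        · nlinarith
      _ = _ := by rw [Real.rpow_neg (by norm_num)]; rfl
  have hk0 : 0 < ⌈2 * Λ / len⌉₊ := Nat.ceil_pos.2 (by positivity)
  have hk : 2 * (⌈2 * Λ / len⌉₊ - 1) ≤ h := by
    have h1 := Nat.ceil_lt_add_one (a := 2 * Λ / len) (by positivity)
    have h2 : (2 : ℝ) * (⌈2 * Λ / len⌉₊ - 1 : ℕ) ≤ h := by
      rw [Nat.cast_sub hk0, Nat.cast_one]
      have : 2 * Λ / len = 2 * (Λ / len) := by ring
      linarith
    exact_mod_cast h2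
  have hterm := hkey _ (Nat.le_ceil _) hk0
  have hz := CylVertex.length_sinkList hhpos
  have hne : (cylinder h).sinkList ≠ [] := by
    intro h0; rw [h0] at hz; simp at hz; omega
  have hDI := fun O => (cylinder h).card_sampledIndices_le (δ := 2) len q' X O hne
  rw [hz] at hDI
  -- For `Λ` above one label, `2 * |X|` sinks are looked up with high probability. The initial state
  -- is then bounded by the same estimate as any other low state; `Δ` serves only to put it below
  -- `Λ`.
  by_cases hc : (len : ℝ) < Λ
  · rw [if_pos hc]
    have hx1 : 1 < Λ / len := by rwa [lt_div_iff₀ hl, one_mul]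
    have hX1 : (X.card : ℝ) < Λ / len + 1 := by
      rw [hX]; exact Nat.ceil_lt_add_one hx.le
    have hX2 : Λ / len ≤ X.card := by rw [hX]; exact Nat.le_ceil _
    have hk2 : ⌈2 * Λ / len⌉₊ ≤ 2 * X.card := by
      rw [Nat.ceil_le]; push_cast
      have : 2 * Λ / len = 2 * (Λ / len) := by ring
      linarith
    have h8 : 4 * (2 * X.card) ≤ h := by
      have : (4 : ℝ) * (2 * X.card) ≤ h := by linarith
      exact_mod_cast this
    have hXpos : (1 : ℝ) ≤ X.card := hx1.le.trans hX2
    have hcount := ncard_card_sampledIndices_lt_le (V := CylVertex h) (δ := 2) hq hhpos hhlen h8 X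
    have hp : ({O : Oracle (Query (CylVertex h) 2 κ) κ | {v | ∃ x ∈ X, ∃ m < q',
        (cylinder h).LooksUp len O x m v}.ncard < ⌈2 * Λ / len⌉₊}.ncard : ℝ) ≤
        1 / (2 : ℝ) ^ ((q' : ℝ) / 2) * Nat.card (Oracle (Query (CylVertex h) 2 κ) κ) := by
      have hsub : ({O : Oracle (Query (CylVertex h) 2 κ) κ | {v | ∃ x ∈ X, ∃ m < q',
          (cylinder h).LooksUp len O x m v}.ncard < ⌈2 * Λ / len⌉₊}.ncard : ℝ) ≤
          ({O : Oracle (Query (CylVertex h) 2 κ) κ |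
            (sampledIndices len q' h X O).card < 2 * X.card}.ncard : ℝ) := by
        refine Nat.cast_le.2 (Set.ncard_le_ncard (fun O hO => ?_) (Set.toFinite _))
        exact ((hDI O).trans_lt hO).trans_le hk2
      refine hsub.trans ?_
      have h1 : ({O : Oracle (Query (CylVertex h) 2 κ) κ |
            (sampledIndices len q' h X O).card < 2 * X.card}.ncard : ℝ) * 2 ^ (q' * X.card) ≤
          (h : ℝ) ^ (2 * X.card) * Nat.card (Oracle (Query (CylVertex h) 2 κ) κ) := by
        exact_mod_cast hcount
      -- As `h ^ 4 ≤ 2 ^ q'`, the union bound over index sets costs at most the square root of the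
      -- gain.
      have h2 : (h : ℝ) ^ (2 * X.card) ≤ (2 : ℝ) ^ ((q' : ℝ) / 2 * X.card) := by
        have h3 : (h : ℝ) ^ 2 ≤ (2 : ℝ) ^ ((q' : ℝ) / 2) := by
          refine (pow_le_pow_iff_left₀ (by positivity) (by positivity) two_ne_zero).1 ?_
          rw [← pow_mul, ← Real.rpow_natCast (_ ^ _) 2, ← Real.rpow_mul (by norm_num)]
          refine (hh hc).trans (le_of_eq ?_)
          rw [← Real.rpow_natCast]
          congr 1; push_cast; ring
        rw [pow_mul, Real.rpow_mul (by norm_num), Real.rpow_natCast]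
        gcongr
      have h4 : (2 : ℝ) ^ (q' * X.card) =
          (2 : ℝ) ^ ((q' : ℝ) / 2 * X.card) * (2 : ℝ) ^ ((q' : ℝ) / 2 * X.card) := by
        rw [← Real.rpow_add (by norm_num), ← Real.rpow_natCast]
        congr 1; push_cast; ring
      have h5 : (2 : ℝ) ^ ((q' : ℝ) / 2) ≤ (2 : ℝ) ^ ((q' : ℝ) / 2 * X.card) := by
        gcongr
        · norm_num
        · nlinarith [Nat.cast_nonneg (α := ℝ) q']
      set N : ℝ := (Nat.card (Oracle (Query (CylVertex h) 2 κ) κ) : ℝ)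
      set Y : ℝ := (2 : ℝ) ^ ((q' : ℝ) / 2 * X.card)
      have hY : 0 < Y := by positivity
      have hN : 0 ≤ N := Nat.cast_nonneg _
      rw [div_mul_eq_mul_div, one_mul, le_div_iff₀ (by positivity)]
      rw [h4, ← mul_assoc] at h1
      have h6 := h1.trans (mul_le_mul_of_nonneg_right h2 hN)
      rw [mul_comm Y N] at h6
      have h7 := le_of_mul_le_mul_right h6 hY
      exact (mul_le_mul_of_nonneg_left h5 (Nat.cast_nonneg _)).trans h7
    refine (unifProb_success_le hlen hq R hT hbatch hk hΛ.le hb₀ (by linarith) hR hp).trans ?_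
    gcongr
    have h1 : 2 * (2 : ℝ) ^ (Λ - Δ) * (m / 2 ^ len) ^ ⌈2 * Λ / len⌉₊ ≤
        2 * (2 : ℝ) ^ Λ * (m / 2 ^ len) ^ ⌈2 * Λ / len⌉₊ := by
      gcongr
      · norm_num
      · linarith
    have h2 : 0 ≤ 2 * M / (2 : ℝ) ^ Δ := by positivity
    linarith
  -- Here `X` is a single input, and some sink is certainly looked up because `q' > 0`. At most `len
  -- - Δ` initial bits against one needed label save `Δ` bits, up to the hint.
  · rw [if_neg hc]
    have hx1 : Λ / len ≤ 1 := by rw [div_le_one hl]; linarith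
    have hX1 : X.card = 1 := by
      rw [hX]
      refine le_antisymm (Nat.ceil_le.2 (by simpa using hx1)) (Nat.ceil_pos.2 hx)
    have hp : ({O : Oracle (Query (CylVertex h) 2 κ) κ | {v | ∃ x ∈ X, ∃ m < q',
        (cylinder h).LooksUp len O x m v}.ncard < 1}.ncard : ℝ) ≤
        0 * Nat.card (Oracle (Query (CylVertex h) 2 κ) κ) := by
      rw [zero_mul]
      refine le_of_eq ?_
      rw [Nat.cast_eq_zero, Set.ncard_eq_zero, Set.eq_empty_iff_forall_notMem]
      intro O hO
      have h1 := (hDI O).trans_lt hO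
      rw [Nat.lt_one_iff, Finset.card_eq_zero, sampledIndices, Finset.image_eq_empty,
        Finset.product_eq_empty, Finset.range_eq_empty_iff, ← Finset.card_eq_zero] at h1
      omega
    refine (unifProb_success_le hlen hq R hT hbatch hk hΛ.le hb₀ (by linarith) hR hp).trans ?_
    gcongr
    have h1 : 2 * (2 : ℝ) ^ (Λ - Δ) * (m / 2 ^ len) ^ 1 ≤ 2 * M / (2 : ℝ) ^ Δ := by
      rw [pow_one, Real.rpow_sub (by norm_num)]
      have h2 : (2 : ℝ) ^ Λ ≤ (2 : ℝ) ^ len := by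
        rw [← Real.rpow_natCast]
        gcongr
        · norm_num
        · exact not_lt.1 hc
      calc 2 * ((2 : ℝ) ^ Λ / (2 : ℝ) ^ Δ) * (m / 2 ^ len)
          = 2 * m / (2 : ℝ) ^ Δ * ((2 : ℝ) ^ Λ / 2 ^ len) := by ring
        _ ≤ 2 * m / (2 : ℝ) ^ Δ * 1 := by
          gcongr
          rw [div_le_one (by positivity)]; exact h2
        _ ≤ _ := by rw [mul_one]; gcongr
    have h2 : 0 ≤ 2 / (2 : ℝ) ^ ((len : ℝ) / 4) := by positivity
    linarith

/-! ### Asymptotics -/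

theorem eventually_pow_le_two_rpow {f : ℕ → ℝ}
    (hf : ∀ K : ℝ, 0 ≤ K → ∀ᶠ κ : ℕ in atTop, K * Real.log κ ≤ f κ) (a : ℕ) :
    ∀ᶠ κ : ℕ in atTop, (κ : ℝ) ^ a ≤ (2 : ℝ) ^ f κ := by
  have hlog2 : 0 < Real.log 2 := Real.log_pos (by norm_num)
  filter_upwards [hf (a / Real.log 2) (by positivity), eventually_gt_atTop 0] with κ h1 h2
  have hκ : (0 : ℝ) < κ := by exact_mod_cast h2
  rw [← Real.log_le_log_iff (by positivity) (by positivity), Real.log_pow,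
    Real.log_rpow (by norm_num)]
  rw [div_mul_eq_mul_div, div_le_iff₀ hlog2] at h1
  exact h1

theorem eventually_mul_log_le_of_isLittleO {f : ℕ → ℝ} (h0 : ∀ κ, 0 ≤ f κ)
    (hf : (fun κ : ℕ => Real.log κ) =o[atTop] f) (K : ℝ) (hK : 0 ≤ K) :
    ∀ᶠ κ : ℕ in atTop, K * Real.log κ ≤ f κ := by
  filter_upwards [hf.bound (c := 1 / (K + 1)) (by positivity), eventually_ge_atTop 1] with κ h1 h2
  have hlog : 0 ≤ Real.log κ := Real.log_natCast_nonneg κ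
  rw [Real.norm_of_nonneg hlog, Real.norm_of_nonneg (h0 κ), div_mul_eq_mul_div, one_mul,
    le_div_iff₀ (by positivity)] at h1
  linarith

theorem Polynomial.exists_eval_le_pow (p : Polynomial ℕ) :
    ∃ a : ℕ, ∀ κ : ℕ, 2 ≤ κ → p.eval κ ≤ κ ^ a := by
  induction p using Polynomial.induction_on' with
  | add p q hp hq =>
    obtain ⟨a, ha⟩ := hp
    obtain ⟨b, hb⟩ := hq
    refine ⟨a + b + 1, fun κ hκ => ?_⟩
    rw [Polynomial.eval_add]
    have h1 := (ha κ hκ).trans (Nat.pow_le_pow_right (by omega) (Nat.le_add_right a b))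
    have h2 := (hb κ hκ).trans (Nat.pow_le_pow_right (by omega) (Nat.le_add_left b a))
    calc p.eval κ + q.eval κ ≤ κ ^ (a + b) + κ ^ (a + b) := Nat.add_le_add h1 h2
      _ = κ ^ (a + b) * 2 := by ring
      _ ≤ κ ^ (a + b) * κ := Nat.mul_le_mul_left _ hκ
      _ = _ := (pow_succ _ _).symm
  | monomial n c =>
    refine ⟨n + c, fun κ hκ => ?_⟩
    rw [Polynomial.eval_monomial, pow_add, mul_comm]
    exact Nat.mul_le_mul_left _ ((Nat.lt_pow_self (by omega : 1 < κ)).le)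

theorem Polynomial.eval_mono_nat (p : Polynomial ℕ) : Monotone fun x : ℕ => p.eval x := by
  intro x y hxy
  simp only [Polynomial.eval_eq_sum]
  exact Finset.sum_le_sum fun i _ => Nat.mul_le_mul_left _ (Nat.pow_le_pow_left hxy i)

theorem negligible_of_forall_eventually {ε : ℕ → ℝ} (h0 : ∀ κ, 0 ≤ ε κ) (C : ℝ)
    (h : ∀ d : ℕ, ∀ᶠ κ : ℕ in atTop, (κ : ℝ) ^ d * ε κ ≤ C) : Negligible ε := by
  intro d
  have h1 : Tendsto (fun κ : ℕ => C / (κ : ℝ)) atTop (nhds 0) :=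
    tendsto_const_div_atTop_nhds_zero_nat C
  refine tendsto_of_tendsto_of_tendsto_of_le_of_le' tendsto_const_nhds h1
    (Eventually.of_forall fun κ => mul_nonneg (by positivity) (h0 κ)) ?_
  filter_upwards [h (d + 1), eventually_gt_atTop 0] with κ h2 h3
  have hκ : (0 : ℝ) < κ := by exact_mod_cast h3
  rw [le_div_iff₀ hκ]
  calc (κ : ℝ) ^ d * ε κ * κ = (κ : ℝ) ^ (d + 1) * ε κ := by ring
    _ ≤ C := h2

end Bounds

theorem PROMAlg.sustainedMem_anti {Q : Type} {κ : ℕ} {α : Type} {A : PROMAlg Q κ α}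
    {O : Oracle Q κ} {ρ : Fin A.coins → Bool} {R : List Bool} {T : ℕ}
    (hT : (A.config O ρ R T).halt = true) {Λ Λ' : ℝ} (hΛ : Λ' ≤ Λ) :
    A.sustainedMem Λ O ρ R ≤ A.sustainedMem Λ' O ρ R := by
  refine Set.ncard_le_ncard (fun i hi => ⟨hi.1, hΛ.trans hi.2⟩) ?_
  refine (Set.finite_lt_nat T).subset fun i hi => ?_
  by_contra hTi
  have h1 := A.halt_of_le O ρ R (not_lt.1 hTi) hT
  rw [hi.1] at h1
  cases h1

theorem unifProb_mono {Ω : Type} [Finite Ω] {E F : Set Ω} (h : E ⊆ F) :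
    unifProb E ≤ unifProb F := by
  rw [unifProb, unifProb, Nat.card_coe_set_eq, Nat.card_coe_set_eq]
  have := Set.ncard_le_ncard h (Set.toFinite F)
  gcongr

theorem unifProb_nonneg {Ω : Type} [Finite Ω] (E : Set Ω) : 0 ≤ unifProb E := by
  rw [unifProb]; positivity

theorem card_cylVertex (h : ℕ) : Fintype.card (CylVertex h) = 2 * h * h := by
  rw [show Fintype.card (CylVertex h) = Fintype.card (Fin (2 * h) × Fin h) from rfl]
  simp

theorem sqrt_card_cylVertex (h : ℕ) : √(Fintype.card (CylVertex h) : ℝ) = √2 * h := by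
  rw [card_cylVertex]
  push_cast
  rw [mul_assoc, Real.sqrt_mul (by norm_num), Real.sqrt_mul_self (Nat.cast_nonneg h)]

/-! ### Growth of the number of look-ups and of the height -/

section Sequences

variable {h q' : ℕ → ℕ} {Λ : ℕ → ℝ}

theorem eventually_const_le_of_isLittleO_log {f : ℕ → ℝ} (h0 : ∀ κ, 0 ≤ f κ)
    (hf : (fun κ : ℕ => Real.log κ) =o[atTop] f) (K : ℝ) : ∀ᶠ κ in atTop, K ≤ f κ := by
  have h1 : Tendsto (fun κ : ℕ => Real.log (κ : ℝ)) atTop atTop :=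
    Real.tendsto_log_atTop.comp tendsto_natCast_atTop_atTop
  filter_upwards [eventually_mul_log_le_of_isLittleO h0 hf 1 zero_le_one,
    h1.eventually_ge_atTop K] with κ h2 h3
  linarith

/-- The number of look-ups is superlogarithmic where the static string is longer than a label. -/
theorem eventually_mul_log_le_lookups
    (hlog : (fun κ : ℕ => Real.log κ) =o[atTop] fun κ => ((κ / q' κ : ℕ) : ℝ))
    (hΛ : (fun κ => Real.log (Λ κ)) =o[atTop] fun κ => (q' κ : ℝ)) (K : ℝ) (hK : 0 ≤ K) :
    ∀ᶠ κ : ℕ in atTop, ((κ / q' κ : ℕ) : ℝ) < Λ κ → K * Real.log κ ≤ (q' κ : ℝ) / 2 := by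
  have hsqrt : (fun κ : ℕ => Real.log κ) =o[atTop] fun κ : ℕ => √(κ : ℝ) := by
    have := (isLittleO_log_rpow_atTop (r := 1 / 2) (by norm_num)).comp_tendsto
      tendsto_natCast_atTop_atTop
    simpa only [Function.comp_def, ← Real.sqrt_eq_rpow] using this
  filter_upwards [eventually_mul_log_le_of_isLittleO (fun κ => Real.sqrt_nonneg _) hsqrt (2 * K)
    (by positivity), hΛ.bound (c := 1 / (8 * (K + 1))) (by positivity), eventually_ge_atTop 16,
    eventually_const_le_of_isLittleO_log (fun κ => Nat.cast_nonneg _) hlog 1]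
    with κ h1 h2 h3 h4 h5
  have hq0 : 0 < q' κ := by
    rcases Nat.eq_zero_or_pos (q' κ) with h0 | h0
    · rw [h0, Nat.div_zero] at h4; norm_num at h4
    · exact h0
  -- If `q' > √κ`, nothing is left to show. Otherwise labels have order at least `√κ` bits, so `Λ >
  -- len ≥ κ ^ (1 / 4)`, and `ω(log Λ)` is `ω(log κ)`.
  by_cases hc : q' κ * q' κ ≤ κ
  · set l := κ / q' κ with hl
    have hl1 : 1 ≤ l := by exact_mod_cast h4
    have hlt : κ < (l + 1) * q' κ := by
      rw [mul_comm]; exact Nat.lt_mul_div_succ κ hq0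
    have hle : κ ≤ 4 * (l * l) := by
      by_contra hcon
      have h7 : κ * κ < ((l + 1) * q' κ) * ((l + 1) * q' κ) := Nat.mul_lt_mul'' hlt hlt
      have h8 : ((l + 1) * q' κ) * ((l + 1) * q' κ) ≤ (2 * l * (2 * l)) * κ := by
        calc ((l + 1) * q' κ) * ((l + 1) * q' κ) = ((l + 1) * (l + 1)) * (q' κ * q' κ) := by ring
          _ ≤ (2 * l * (2 * l)) * κ := by gcongr <;> omega
      have h9 := (h7.trans_le h8)
      have := Nat.lt_of_mul_lt_mul_right h9
      nlinarith
    have hle4 : κ ≤ l ^ 4 := by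
      have h7 : κ * κ ≤ (4 * (l * l)) * (4 * (l * l)) := Nat.mul_le_mul hle hle
      have h8 : 16 * κ ≤ κ * κ := Nat.mul_le_mul_right _ h3
      have : (4 * (l * l)) * (4 * (l * l)) = 16 * l ^ 4 := by ring
      omega
    have hlpos : (0 : ℝ) < l := by exact_mod_cast hl1
    have hκ : (0 : ℝ) < κ := by exact_mod_cast (by omega : 0 < κ)
    have h7 : Real.log κ ≤ 4 * Real.log (Λ κ) := by
      calc Real.log κ ≤ Real.log ((l : ℝ) ^ 4) := Real.log_le_log hκ (by exact_mod_cast hle4)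
        _ = 4 * Real.log l := by rw [Real.log_pow]; norm_num
        _ ≤ 4 * Real.log (Λ κ) := by
          have := Real.log_le_log hlpos h5.le
          linarith
    have h8 := (le_abs_self _).trans h2
    rw [Real.norm_of_nonneg (Nat.cast_nonneg _), div_mul_eq_mul_div, one_mul,
      le_div_iff₀ (by positivity)] at h8
    have h9 : 0 ≤ Real.log (Λ κ) := by
      have := Real.log_natCast_nonneg κ
      linarith
    nlinarith
  · have h6 : √(κ : ℝ) ≤ q' κ := by
      rw [Real.sqrt_le_left (Nat.cast_nonneg _), sq]
      exact_mod_cast (not_le.1 hc).le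
    linarith

/-- Where `C ≤ len < Λ`, the height is at most `C * Λ ≤ Λ ^ 2`, and `Λ ^ 8 ≤ 2 ^ q'` because `q'`
outgrows `log Λ`. -/
theorem eventually_height_pow_le
    (hlog : (fun κ : ℕ => Real.log κ) =o[atTop] fun κ => ((κ / q' κ : ℕ) : ℝ))
    (hΛ : (fun κ => Real.log (Λ κ)) =o[atTop] fun κ => (q' κ : ℝ)) {C : ℝ}
    (hh : ∀ᶠ κ in atTop, 0 < Λ κ → (h κ : ℝ) ≤ C * Λ κ) :
    ∀ᶠ κ : ℕ in atTop, ((κ / q' κ : ℕ) : ℝ) < Λ κ → (h κ : ℝ) ^ 4 ≤ 2 ^ q' κ := by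
  have hlog2 : 0 < Real.log 2 := Real.log_pos (by norm_num)
  filter_upwards [hh, hΛ.bound (c := Real.log 2 / 8) (by positivity),
    eventually_const_le_of_isLittleO_log (fun κ => Nat.cast_nonneg _) hlog C] with κ h1 h2 h3 h4
  have hΛ0 : 0 < Λ κ := (Nat.cast_nonneg _).trans_lt h4
  have h5 : (h κ : ℝ) ≤ Λ κ ^ 2 := by
    refine (h1 hΛ0).trans ?_
    rw [sq]
    gcongr
    linarith
  have h6 := (le_abs_self _).trans h2
  rw [Real.norm_of_nonneg (Nat.cast_nonneg _)] at h6
  calc (h κ : ℝ) ^ 4 ≤ (Λ κ ^ 2) ^ 4 := by gcongr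
    _ = Λ κ ^ 8 := by ring
    _ ≤ 2 ^ q' κ := by
      rw [← Real.log_le_log_iff (by positivity) (by positivity), Real.log_pow, Real.log_pow]
      push_cast
      linarith

end Sequences

/-- Hardness, where the bound `Λ` on the memory is at most a small multiple of the height, counted
in labels, and at least a multiple of the height, counted in bits. -/
theorem isHardSHF_cylinderHash {h q' : ℕ → ℕ} {ζ : ∀ κ, BitVec κ} {lam Λ : ℕ → ℝ} {C : ℝ}
    (hpoly : ∃ p : Polynomial ℕ, ∀ κ, h κ ≤ p.eval κ)
    (hlog : (fun κ : ℕ => Real.log κ) =o[atTop] fun κ => ((κ / q' κ : ℕ) : ℝ))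
    (hlam : ∀ κ, 0 ≤ lam κ)
    (hup : ∀ᶠ κ in atTop, Λ κ / ((κ / q' κ : ℕ) : ℝ) ≤ h κ / 32)
    (hlow : ∀ᶠ κ in atTop, 0 < Λ κ → (h κ : ℝ) ≤ C * Λ κ)
    (hΛ : (fun κ => Real.log (Λ κ)) =o[atTop] fun κ => (q' κ : ℝ)) :
    IsHardSHF (fun κ => cylinderHash (h κ) (q' κ) κ (ζ κ)) (fun κ => Λ κ - lam κ) h
      (fun κ => ⌈Λ κ / ((κ / q' κ : ℕ) : ℝ)⌉₊) := by
  classical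
  intro Δ hΔ0 hΔ R A ⟨pA, hA⟩ X
  obtain ⟨pH, hpH⟩ := hpoly
  -- The static string has at most `Λ ≤ len * h / 32 ≤ κ * h` bits, so `pT` bounds iterations and
  -- batch sizes in terms of `κ` alone; `pM` bounds the number of hints per label.
  let pT : Polynomial ℕ := pA.comp (Polynomial.X + Polynomial.X * pH)
  let pM : Polynomial ℕ := (2 * pH * pH) * ((pT * pT * 2 + pH * Polynomial.X) * (pT * pT + 1))
  obtain ⟨aH, haH⟩ := pH.exists_eval_le_pow
  obtain ⟨aT, haT⟩ := pT.exists_eval_le_pow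
  obtain ⟨aM, haM⟩ := pM.exists_eval_le_pow
  let E : ∀ κ, Set (Oracle (Query (CylVertex (h κ)) 2 κ) κ × (Fin (A κ).coins → Bool)) := fun κ =>
    {ω | (A κ).output ω.1 ω.2 (R κ ω.1) =
        (fun x => (x, (cylinderHash (h κ) (q' κ) κ (ζ κ)).hash ω.1 x)) '' (X κ : Set (BitVec κ)) ∧
      (A κ).sustainedMem (Λ κ - lam κ) ω.1 ω.2 (R κ ω.1) < h κ}
  let cond : ℕ → Prop := fun κ => (∀ O, ((R κ O).length : ℝ) ≤ Λ κ - lam κ - Δ κ) ∧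
    (X κ).card = ⌈Λ κ / ((κ / q' κ : ℕ) : ℝ)⌉₊
  -- The probability is controlled only where the sizes of `R` and `X` are right, hence the case
  -- distinction. The term `2 ^ (-κ)` makes the inequality strict.
  refine ⟨fun κ => 1 / (2 : ℝ) ^ (κ : ℝ) + if cond κ then unifProb (E κ) else 0, ?_, ?_⟩
  swap
  · refine Eventually.of_forall fun κ h1 h2 => ?_
    simp only
    rw [if_pos ⟨h1, h2⟩]
    have : (0 : ℝ) < 1 / (2 : ℝ) ^ (κ : ℝ) := by positivity
    show unifProb (E κ) < _
    linarith
  refine negligible_of_forall_eventually (fun κ => ?_) 8 fun d => ?_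
  · have := unifProb_nonneg (E κ)
    positivity
  have hκlog : (fun κ : ℕ => Real.log κ) =o[atTop] fun κ : ℕ => (κ : ℝ) :=
    Real.isLittleO_log_id_atTop.comp_tendsto tendsto_natCast_atTop_atTop
  have hlen4 : ∀ a : ℕ, ∀ᶠ κ : ℕ in atTop,
      (κ : ℝ) ^ a ≤ (2 : ℝ) ^ (((κ / q' κ : ℕ) : ℝ) / 4) := by
    refine eventually_pow_le_two_rpow fun K hK => ?_
    filter_upwards [eventually_mul_log_le_of_isLittleO (fun κ => Nat.cast_nonneg _) hlog (4 * K)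
      (by positivity)] with κ hκ
    linarith
  have hq'2 : ∀ᶠ κ : ℕ in atTop, ((κ / q' κ : ℕ) : ℝ) < Λ κ →
      (κ : ℝ) ^ d ≤ (2 : ℝ) ^ ((q' κ : ℝ) / 2) := by
    have := eventually_pow_le_two_rpow (f := fun κ =>
      if ((κ / q' κ : ℕ) : ℝ) < Λ κ then (q' κ : ℝ) / 2 else κ) (fun K hK => by
        filter_upwards [eventually_mul_log_le_lookups hlog hΛ K hK,
          eventually_mul_log_le_of_isLittleO (fun κ => Nat.cast_nonneg _) hκlog K hK] with κ h1 h2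
        split
        · next hc => exact h1 hc
        · exact h2) d
    filter_upwards [this] with κ h1 h2
    rwa [if_pos h2] at h1
  filter_upwards [hup, eventually_height_pow_le hlog hΛ hlow, hq'2, hlen4 aM, hlen4 aH, hlen4 d,
    hlen4 (d + aT), eventually_pow_le_two_rpow (eventually_mul_log_le_of_isLittleO hΔ0 hΔ) (d + aM),
    eventually_pow_le_two_rpow
      (eventually_mul_log_le_of_isLittleO (fun κ => Nat.cast_nonneg _) hκlog) d,
    eventually_const_le_of_isLittleO_log (fun κ => Nat.cast_nonneg _) hlog 1,
    eventually_const_le_of_isLittleO_log hΔ0 hΔ 1, eventually_ge_atTop 2]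
    with κ hup hpow hq'2 hlM hlH hld hldT hΔM hκd hlen1 hΔ1 hκ2
  have hκd' : (κ : ℝ) ^ d * (1 / (2 : ℝ) ^ (κ : ℝ)) ≤ 1 := by
    rw [mul_one_div, div_le_one (by positivity)]; exact hκd
  rw [mul_add]
  by_cases hc : cond κ
  swap
  · rw [if_neg hc]; linarith
  rw [if_pos hc]
  obtain ⟨hR, hX⟩ := hc
  have hlen0 : 0 < κ / q' κ := by exact_mod_cast hlen1
  have hq0 : 0 < q' κ := Nat.pos_of_ne_zero fun h0 => by simp [h0] at hlen0
  have hlenκ : κ / q' κ ≤ κ := Nat.div_le_self _ _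
  have hlam := hlam κ
  have hR' : ∀ O, ((R κ O).length : ℝ) ≤ Λ κ - Δ κ := fun O => (hR O).trans (by linarith)
  have hl : (0 : ℝ) < ((κ / q' κ : ℕ) : ℝ) := by exact_mod_cast hlen0
  have hRlen : ∀ O, (R κ O).length ≤ κ * pH.eval κ := by
    intro O
    have h1 : Λ κ ≤ h κ / 32 * ((κ / q' κ : ℕ) : ℝ) := by rwa [div_le_iff₀ hl] at hup
    have h2 : (h κ : ℝ) / 32 * ((κ / q' κ : ℕ) : ℝ) ≤ h κ * κ := by
      have : (h κ : ℝ) / 32 ≤ h κ := by linarith [Nat.cast_nonneg (α := ℝ) (h κ)]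
      have h3 : ((κ / q' κ : ℕ) : ℝ) ≤ κ := by exact_mod_cast hlenκ
      gcongr
    have h4 : ((R κ O).length : ℝ) ≤ h κ * κ := by linarith [hR' O]
    have h5 : (R κ O).length ≤ h κ * κ := by exact_mod_cast h4
    calc (R κ O).length ≤ h κ * κ := h5
      _ ≤ κ * pH.eval κ := by rw [mul_comm]; exact Nat.mul_le_mul_left _ (hpH κ)
  have hTle : ∀ O, pA.eval (κ + (R κ O).length) ≤ pT.eval κ := by
    intro O
    simp only [pT, Polynomial.eval_comp, Polynomial.eval_add, Polynomial.eval_mul,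
      Polynomial.eval_X]
    exact pA.eval_mono_nat (Nat.add_le_add_left (hRlen O) κ)
  have hT : ∀ O ρ, ((A κ).config O ρ (R κ O) (pT.eval κ)).halt = true := fun O ρ =>
    (A κ).halt_of_le O ρ (R κ O) (hTle O) (hA κ O ρ (R κ O)).1
  have hbatch : ∀ O ρ i, ((A κ).batch O ρ (R κ O) i).length ≤ pT.eval κ := by
    intro O ρ i
    rw [PROMAlg.batch]
    split
    · exact Nat.zero_le _
    · next hh => exact ((hA κ O ρ (R κ O)).2 i (by simpa using hh)).trans (hTle O)
  have hXh : (X κ).card ≤ h κ := by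
    rw [hX, Nat.ceil_le]
    linarith [Nat.cast_nonneg (α := ℝ) (h κ)]
  have hM : (DAG.hintCount (CylVertex (h κ)) 2 (q' κ) (pT.eval κ) (X κ).card : ℝ) ≤
      ((pM.eval κ : ℕ) : ℝ) := by
    refine Nat.cast_le.2 ?_
    rw [DAG.hintCount, card_cylVertex]
    simp only [pM, Polynomial.eval_mul, Polynomial.eval_add, Polynomial.eval_X,
      Polynomial.eval_one, Polynomial.eval_ofNat]
    have h1 := hpH κ
    have h2 := hXh.trans h1
    have h3 : q' κ ≤ κ := by
      by_contra h0
      rw [Nat.div_eq_of_lt (not_le.1 h0)] at hlen0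
      omega
    gcongr
  have hpMκ : ((pM.eval κ : ℕ) : ℝ) ≤ (κ : ℝ) ^ aM := by exact_mod_cast haM κ hκ2
  have hpTκ : ((pT.eval κ : ℕ) : ℝ) ≤ (κ : ℝ) ^ aT := by exact_mod_cast haT κ hκ2
  have hhlen : h κ ≤ 2 ^ (κ / q' κ) := by
    have h1 : (h κ : ℝ) ≤ (2 : ℝ) ^ (κ / q' κ) := by
      calc (h κ : ℝ) ≤ (κ : ℝ) ^ aH := by exact_mod_cast (hpH κ).trans (haH κ hκ2)
        _ ≤ _ := hlH
        _ ≤ (2 : ℝ) ^ (((κ / q' κ : ℕ) : ℝ)) := by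
          gcongr
          · norm_num
          · linarith
        _ = _ := Real.rpow_natCast _ _
    exact_mod_cast h1
  have hmain := unifProb_success_le_of_params (ζ := ζ κ) hq0 hlen0 hlenκ (Nat.div_mul_le_self _ _)
    (R κ) hT hbatch (by linarith) hR' hX hup hM (hpMκ.trans hlM) hhlen hpow
  -- Lowering the threshold by `lam` only increases the sustained memory and shortens the static
  -- string, so the bound for `Λ` applies.
  have hE := hmain.trans' (unifProb_mono (E := E κ) fun ω hω => ⟨hω.1,
    (PROMAlg.sustainedMem_anti (hT ω.1 ω.2) (by linarith)).trans_lt hω.2⟩)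
  have hterm1 : (κ : ℝ) ^ d * (((pT.eval κ : ℕ) : ℝ) *
      (2 / (2 : ℝ) ^ (((κ / q' κ : ℕ) : ℝ) / 4))) ≤ 2 := by
    rw [← mul_assoc, mul_div_assoc', div_le_iff₀ (by positivity)]
    have : (κ : ℝ) ^ d * ((pT.eval κ : ℕ) : ℝ) ≤ (2 : ℝ) ^ (((κ / q' κ : ℕ) : ℝ) / 4) := by
      refine le_trans ?_ hldT
      rw [pow_add]
      gcongr
    linarith
  have hterm2 : (κ : ℝ) ^ d * (2 / (2 : ℝ) ^ (((κ / q' κ : ℕ) : ℝ) / 4)) ≤ 2 := by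
    rw [mul_div_assoc', div_le_iff₀ (by positivity)]
    linarith
  have hterm3 : (κ : ℝ) ^ d * (2 * ((pM.eval κ : ℕ) : ℝ) / (2 : ℝ) ^ Δ κ) ≤ 2 := by
    rw [mul_div_assoc', div_le_iff₀ (by positivity)]
    have : (κ : ℝ) ^ d * ((pM.eval κ : ℕ) : ℝ) ≤ (2 : ℝ) ^ Δ κ := by
      refine le_trans ?_ hΔM
      rw [pow_add]
      gcongr
    linarith
  have hterm4 : (κ : ℝ) ^ d * (if ((κ / q' κ : ℕ) : ℝ) < Λ κ then
      1 / (2 : ℝ) ^ ((q' κ : ℝ) / 2) else 0) ≤ 1 := by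
    split
    · next hc => rw [mul_one_div, div_le_one (by positivity)]; exact hq'2 hc
    · simp
  have := mul_le_mul_of_nonneg_left hE (by positivity : 0 ≤ (κ : ℝ) ^ d)
  rw [mul_add, mul_add, mul_add] at this
  linarith

theorem mainTheorem2 :
    ∃ c : ℝ, 0 < c ∧
    ∀ (h q' : ℕ → ℕ) (ζ : ∀ κ, BitVec κ) (n : ℕ → ℕ) (len : ℕ → ℕ),
      (∀ κ, n κ = Fintype.card (CylVertex (h κ))) →
      (∀ κ, len κ = κ / q' κ) →
      (∃ p : Polynomial ℕ, ∀ κ, h κ ≤ p.eval κ) →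
      (fun κ : ℕ => Real.log κ) =o[atTop] (fun κ => (len κ : ℝ)) →
    ∀ lam Λ : ℕ → ℝ,
      (∀ κ, 0 ≤ lam κ) →
      (Λ =Θ[atTop] (fun κ => √(n κ : ℝ)) ∨
        ((fun κ => Λ κ / (len κ : ℝ)) =Θ[atTop] (fun κ => √(n κ : ℝ)) ∧
          ∀ᶠ κ in atTop, Λ κ / (len κ : ℝ) ≤ c * √(n κ : ℝ))) →
      (fun κ => Real.log (Λ κ)) =o[atTop] (fun κ => (q' κ : ℝ)) →
    ∃ τ : ℕ → ℕ, (fun κ => (τ κ : ℝ)) =Θ[atTop] (fun κ => √(n κ : ℝ)) ∧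
      IsHardSHF (fun κ => cylinderHash (h κ) (q' κ) κ (ζ κ)) (fun κ => Λ κ - lam κ) τ
        (fun κ => ⌈Λ κ / (len κ : ℝ)⌉₊) := by
  -- `√n = √2 * h ≤ 2 * h`, so `√n / 64 ≤ h / 32`.
  refine ⟨1 / 64, by norm_num, ?_⟩
  intro h q' ζ n len hn hlen hpoly hlog lam Λ hlam hΛ hΛlog
  obtain rfl : len = fun κ => κ / q' κ := funext hlen
  have hsqrt : ∀ κ, √(n κ : ℝ) = √2 * h κ := fun κ => by rw [hn, sqrt_card_cylVertex]
  have h2lo : (1 : ℝ) ≤ √2 := Real.one_le_sqrt.2 (by norm_num)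
  have h2hi : √2 ≤ (2 : ℝ) := Real.sqrt_le_iff.2 ⟨by norm_num, by norm_num⟩
  have hlen1 := eventually_const_le_of_isLittleO_log (fun κ => Nat.cast_nonneg _) hlog 1
  have hhn : ∀ κ, (h κ : ℝ) ≤ √(n κ : ℝ) := fun κ => by
    rw [hsqrt]
    nlinarith [Nat.cast_nonneg (α := ℝ) (h κ)]
  have hup : ∀ᶠ κ in atTop, Λ κ / ((κ / q' κ : ℕ) : ℝ) ≤ h κ / 32 := by
    rcases hΛ with hΛ | ⟨-, hΛ⟩
    -- When `Λ` is counted in bits, any constant is eventually absorbed by the growing label length.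
    · obtain ⟨C, hC, hbound⟩ := hΛ.1.exists_pos
      filter_upwards [hbound.bound, hlen1,
        eventually_const_le_of_isLittleO_log (fun κ => Nat.cast_nonneg _) hlog (C * 64)]
        with κ h1 h2 h3
      have h4 := (le_abs_self _).trans h1
      rw [Real.norm_of_nonneg (Real.sqrt_nonneg _), hsqrt] at h4
      rw [div_le_iff₀ (by linarith)]
      have hh : (0 : ℝ) ≤ h κ := Nat.cast_nonneg _
      calc Λ κ ≤ C * (√2 * h κ) := h4
        _ ≤ C * (2 * h κ) := by gcongr
        _ = h κ / 32 * (C * 64) := by ring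
        _ ≤ _ := by gcongr
    · filter_upwards [hΛ] with κ h1
      rw [hsqrt] at h1
      have hh : (0 : ℝ) ≤ h κ := Nat.cast_nonneg _
      nlinarith
  -- The `Θ` hypotheses bound only absolute values, so positivity of `Λ` has to be assumed.
  have hlow : ∃ C : ℝ, ∀ᶠ κ in atTop, 0 < Λ κ → (h κ : ℝ) ≤ C * Λ κ := by
    rcases hΛ with hΛ | ⟨hΛ, -⟩
    · obtain ⟨C, hC, hbound⟩ := hΛ.2.exists_pos
      refine ⟨C, ?_⟩
      filter_upwards [hbound.bound] with κ h1 h2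
      rw [Real.norm_of_nonneg (Real.sqrt_nonneg _), Real.norm_of_nonneg h2.le] at h1
      exact (hhn κ).trans h1
    · obtain ⟨C, hC, hbound⟩ := hΛ.2.exists_pos
      refine ⟨C, ?_⟩
      filter_upwards [hbound.bound, hlen1] with κ h1 h2 h3
      rw [Real.norm_of_nonneg (Real.sqrt_nonneg _),
        Real.norm_of_nonneg (div_nonneg h3.le (Nat.cast_nonneg _))] at h1
      refine (hhn κ).trans (h1.trans ?_)
      gcongr
      exact div_le_self h3.le h2
  obtain ⟨C, hlow⟩ := hlow
  refine ⟨h, ?_, isHardSHF_cylinderHash hpoly hlog hlam hup hlow hΛlog⟩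
  have hτ : (fun κ => √(n κ : ℝ)) = fun κ => √2 * (h κ : ℝ) := funext hsqrt
  rw [hτ]
  exact (IsTheta.const_mul_left (by positivity) (isTheta_refl _ _)).symm
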